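/- Let $\mathcal C$ be a locally cartesian closed category, i.e. a category with finite limits such that every pullback functor $\Delta_f:\mathcal C/Y\to\mathcal C/X$ (for $f:X\to Y$) has a right adjoint $\Pi_f$. Let $\mathrm{PE}_{\mathcal C}$ be the following category. Its objects are the diagrams $P=(I\xleftarrow{n}D\xrightarrow{d}A\xrightarrow{a}I)$ in $\mathcal C$. A simulation from $P_1$ to $P_2$ (where $P_k=(I_k\xleftarrow{n_k}D_k\xrightarrow{d_k}A_k\xrightarrow{a_k}I_k)$) is given by a span $I_1\xleftarrow{r_1}R\xrightarrow{r_2}I_2$, a pullback $R_A=A_1\times_{I_1}R$, a morphism $\alpha:R_A\to A_2$ over $I_2$, a pullback $R_D=D_2\times_{A_2}R_A$ (along $d_2$ and $\alpha$), a morphism $\beta:R_D\to D_1$ over $A_1$, and a morphism $\gamma:R_D\to R$ such that $r_1\gamma=n_1\beta$ and $r_2\gamma=n_2\pi$, where $\pi:R_D\to D_2$ is the projection. Two simulations are equivalent if there are isomorphisms between their objects $R$, $R_A$, $R_D$ commuting with all the arrows of the two diagrams. Morphisms $P_1\to P_2$ are equivalence classes of simulations. The composite of two simulations is obtained by forming the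 pullbacks $R\times_{I_2}R'$, $R_A\times_{A_2}R'_A$, $R_D\times_{D_2}R'_D$ over the middle object, with the induced arrows; the identity of $P$ is the simulation whose span is $I=I=I$, with $R_A=A$, $R_D=D$, $\alpha=1$, $\beta=1$, $\gamma=n$. Let $\otimes$ be the pointwise product, $P_1\otimes P_2=(I_1\times I_2\xleftarrow{n_1\times n_2}D_1\times D_2\xrightarrow{d_1\times d_2}A_1\times A_2\xrightarrow{a_1\times a_2}I_1\times I_2)$, also defined pointwise on simulations, and let the unit be $1\leftarrow1\to1\to1$. Let $P_2\multimap P_3$ be the polynomial diagram which, in the internal language of $\mathcal C$ (with $\Pi$ and $\Sigma$ interpreted by the right and left adjoints of pullback functors), is given by * the object of states $I_2\times I_3$; * $i_2,i_3\vdash A(i_2,i_3)=\sum_{f:A_2(i_2)\to A_3(i_3)}\ \prod_{a_2:A_2(i_2)}\bigl(D_3(i_3,f(a_2))\to D_2(i_2,a_2)\bigr)$; * $i_2,i_3,f,\varphi\vdash D(f,\varphi)=\sum_{a_2:A_2(i_2)}D_3(i_3,f(a_2))$; * $i_2,i_3,f,\varphi,a_2,d_3\vdash n(f,\varphi,a_2,d_3)=\bigl(n_2(\varphi(a_2)(d_3)),\,n_3(d_3)\bigr):I_2\times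 I_3$. Then $\mathrm{PE}_{\mathcal C}$ with $\otimes$, its unit, and the associativity, unit and symmetry isomorphisms induced by those of the cartesian product of $\mathcal C$, is a symmetric monoidal category, and it is closed: there are a functor $H:\mathrm{PE}_{\mathcal C}^{\mathrm{op}}\times\mathrm{PE}_{\mathcal C}\to\mathrm{PE}_{\mathcal C}$ with $H(P_2,P_3)=P_2\multimap P_3$ for all objects $P_2,P_3$, and bijections $$\mathrm{PE}_{\mathcal C}[P_1\otimes P_2,\,P_3]\;\cong\;\mathrm{PE}_{\mathcal C}[P_1,\,P_2\multimap P_3]$$ natural in $P_1$, $P_2$ and $P_3$. -/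

import Mathlib

open CategoryTheory CategoryTheory.Limits CategoryTheory.MonoidalCategory Opposite

universe v u

set_option linter.unusedSimpArgs false

/-- A category with finite limits is locally cartesian closed when every pullback functor
`Δ_f : C/Y ⥤ C/X` has a right adjoint `Π_f`. -/
class LocallyCartesianClosed (C : Type u) [Category.{v} C] [HasFiniteLimits C] : Prop where
  isLeftAdjoint_pullback : ∀ {X Y : C} (f : X ⟶ Y), (Over.pullback f).IsLeftAdjoint

attribute [instance] LocallyCartesianClosed.isLeftAdjoint_pullback

/-- A polynomial endo-diagram `I ← D → A → I` in `C`: the objects of the category `PE_C`. -/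
structure PE (C : Type u) [Category.{v} C] where
  I : C
  D : C
  A : C
  n : D ⟶ I
  d : D ⟶ A
  a : A ⟶ I

namespace PE

/-- A simulation diagram from `P` to `Q`:
```
  P :  P.I <--n-- P.D --d--> P.A --a--> P.I
        ^          ^          ^          ^
       r₁|        β|        pA|        r₁|
         R <--γ-- RD --qA--> RA --pR-->  R
       r₂|       qD|         α|        r₂|
        v          v          v          v
  Q :  Q.I <--n-- Q.D --d--> Q.A --a--> Q.I
```
which commutes, and whose upper right and lower middle squares are pullbacks. -/
structure Sim {C : Type u} [Category.{v} C] (P Q : PE C) where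
  R : C
  RA : C
  RD : C
  r₁ : R ⟶ P.I
  r₂ : R ⟶ Q.I
  pA : RA ⟶ P.A
  pR : RA ⟶ R
  α : RA ⟶ Q.A
  qA : RD ⟶ RA
  qD : RD ⟶ Q.D
  β : RD ⟶ P.D
  γ : RD ⟶ R
  isPullback_A : IsPullback pA pR P.a r₁
  isPullback_D : IsPullback qD qA Q.d α
  α_a : α ≫ Q.a = pR ≫ r₂
  β_d : β ≫ P.d = qA ≫ pA
  β_n : β ≫ P.n = γ ≫ r₁
  qD_n : qD ≫ Q.n = γ ≫ r₂

/-- Isomorphisms of simulation diagrams: isomorphisms `σR`, `σA`, `σD` commuting with all the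
arrows of the two diagrams. -/
structure SimIso {C : Type u} [Category.{v} C] {P Q : PE C} (S T : Sim P Q) where
  σR : S.R ≅ T.R
  σA : S.RA ≅ T.RA
  σD : S.RD ≅ T.RD
  r₁ : σR.hom ≫ T.r₁ = S.r₁
  r₂ : σR.hom ≫ T.r₂ = S.r₂
  pA : σA.hom ≫ T.pA = S.pA
  pR : σA.hom ≫ T.pR = S.pR ≫ σR.hom
  α : σA.hom ≫ T.α = S.α
  qA : σD.hom ≫ T.qA = S.qA ≫ σA.hom
  qD : σD.hom ≫ T.qD = S.qD
  β : σD.hom ≫ T.β = S.β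
  γ : σD.hom ≫ T.γ = S.γ ≫ σR.hom

/-- Equivalence of simulations. -/
instance simSetoid {C : Type u} [Category.{v} C] (P Q : PE C) : Setoid (Sim P Q) where
  r S T := Nonempty (SimIso S T)
  iseqv :=
    { refl := fun S => ⟨⟨Iso.refl _, Iso.refl _, Iso.refl _, by simp, by simp, by simp, by simp,
        by simp, by simp, by simp, by simp, by simp⟩⟩
      symm := fun {S T} ⟨e⟩ => ⟨⟨e.σR.symm, e.σA.symm, e.σD.symm,
        by simp [← e.r₁], by simp [← e.r₂], by simp [← e.pA],
        by simp [Iso.eq_comp_inv, ← e.pR], by simp [← e.α],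
        by simp [Iso.eq_comp_inv, ← e.qA], by simp [← e.qD], by simp [← e.β],
        by simp [Iso.eq_comp_inv, ← e.γ]⟩⟩
      trans := fun {S T U} ⟨e⟩ ⟨f⟩ => ⟨⟨e.σR.trans f.σR, e.σA.trans f.σA, e.σD.trans f.σD,
        by simp [f.r₁, e.r₁], by simp [f.r₂, e.r₂], by simp [f.pA, e.pA],
        by simp [f.pR, reassoc_of% e.pR], by simp [f.α, e.α],
        by simp [f.qA, reassoc_of% e.qA], by simp [f.qD, e.qD], by simp [f.β, e.β],
        by simp [f.γ, reassoc_of% e.γ]⟩⟩ }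

/-- `IsComp S T U`: the simulation `U`, together with the given comparison maps, is a composite
of `S` and `T`, i.e. it is obtained from them by three pullbacks over the middle polynomial. -/
structure IsComp {C : Type u} [Category.{v} C] {P Q W : PE C} (S : Sim P Q) (T : Sim Q W)
    (U : Sim P W) where
  t : U.R ⟶ S.R
  t' : U.R ⟶ T.R
  u : U.RA ⟶ S.RA
  u' : U.RA ⟶ T.RA
  w : U.RD ⟶ S.RD
  w' : U.RD ⟶ T.RD
  isPullback_t : IsPullback t t' S.r₂ T.r₁
  isPullback_u : IsPullback u u' S.α T.pA
  isPullback_w : IsPullback w w' S.qD T.β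
  r₁ : U.r₁ = t ≫ S.r₁
  r₂ : U.r₂ = t' ≫ T.r₂
  pA : U.pA = u ≫ S.pA
  pR : U.pR ≫ t = u ≫ S.pR
  pR' : U.pR ≫ t' = u' ≫ T.pR
  α : U.α = u' ≫ T.α
  qA : U.qA ≫ u = w ≫ S.qA
  qA' : U.qA ≫ u' = w' ≫ T.qA
  qD : U.qD = w' ≫ T.qD
  β : U.β = w ≫ S.β
  γ : U.γ ≫ t = w ≫ S.γ
  γ' : U.γ ≫ t' = w' ≫ T.γ

/-- Composites are unique up to equivalence, and depend on the equivalence classes only. -/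
theorem IsComp.unique {C : Type u} [Category.{v} C] {P Q W : PE C} {S S' : Sim P Q}
    {T T' : Sim Q W} {U U' : Sim P W} (c : IsComp S T U) (c' : IsComp S' T' U')
    (e : SimIso S S') (f : SimIso T T') : Nonempty (SimIso U U') := by
  have mk : ∀ {X Y Z B X' Y' Z' : C} {p : Z ⟶ X} {q : Z ⟶ Y} {g : X ⟶ B} {h : Y ⟶ B}
      {p' : Z' ⟶ X'} {q' : Z' ⟶ Y'} {g' : X' ⟶ B} {h' : Y' ⟶ B}
      (_ : IsPullback p q g h) (_ : IsPullback p' q' g' h') (i : X ≅ X') (j : Y ≅ Y')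
      (_ : i.hom ≫ g' = g) (_ : j.hom ≫ h' = h),
      ∃ k : Z ≅ Z', k.hom ≫ p' = p ≫ i.hom ∧ k.hom ≫ q' = q ≫ j.hom := by
    intro X Y Z B X' Y' Z' p q g h p' q' g' h' H H' i j hi hj
    refine ⟨⟨H'.lift (p ≫ i.hom) (q ≫ j.hom) (by simp [hi, hj, H.w]),
      H.lift (p' ≫ i.inv) (q' ≫ j.inv) (by simp [← hi, ← hj, H'.w]), ?_, ?_⟩, ?_, ?_⟩
    · apply H.hom_ext <;> simp
    · apply H'.hom_ext <;> simp
    · simp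
    · simp
  obtain ⟨kR, hR, hR'⟩ := mk c.isPullback_t c'.isPullback_t e.σR f.σR e.r₂ f.r₁
  obtain ⟨kA, hA, hA'⟩ := mk c.isPullback_u c'.isPullback_u e.σA f.σA e.α f.pA
  obtain ⟨kD, hD, hD'⟩ := mk c.isPullback_w c'.isPullback_w e.σD f.σD e.qD f.β
  refine ⟨⟨kR, kA, kD, ?_, ?_, ?_, ?_, ?_, ?_, ?_, ?_, ?_⟩⟩
  · rw [c'.r₁, c.r₁, reassoc_of% hR, e.r₁]
  · rw [c'.r₂, c.r₂, reassoc_of% hR', f.r₂]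
  · rw [c'.pA, c.pA, reassoc_of% hA, e.pA]
  · apply c'.isPullback_t.hom_ext
    · rw [Category.assoc, c'.pR, reassoc_of% hA, e.pR, Category.assoc, hR, reassoc_of% c.pR]
    · rw [Category.assoc, c'.pR', reassoc_of% hA', f.pR, Category.assoc, hR', reassoc_of% c.pR']
  · rw [c'.α, c.α, reassoc_of% hA', f.α]
  · apply c'.isPullback_u.hom_ext
    · rw [Category.assoc, c'.qA, reassoc_of% hD, e.qA, Category.assoc, hA, reassoc_of% c.qA]
    · rw [Category.assoc, c'.qA', reassoc_of% hD', f.qA, Category.assoc, hA', reassoc_of% c.qA']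
  · rw [c'.qD, c.qD, reassoc_of% hD', f.qD]
  · rw [c'.β, c.β, reassoc_of% hD, e.β]
  · apply c'.isPullback_t.hom_ext
    · rw [Category.assoc, c'.γ, reassoc_of% hD, e.γ, Category.assoc, hR, reassoc_of% c.γ]
    · rw [Category.assoc, c'.γ', reassoc_of% hD', f.γ, Category.assoc, hR', reassoc_of% c.γ']

/-- The reflexive isomorphism of simulations. -/
def SimIso.refl {C : Type u} [Category.{v} C] {P Q : PE C} (S : Sim P Q) : SimIso S S :=
  ⟨Iso.refl _, Iso.refl _, Iso.refl _, by simp, by simp, by simp, by simp,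
    by simp, by simp, by simp, by simp, by simp⟩

/-- The composite of two simulation diagrams: its objects are the pullbacks of those of `S` and
`T` over the middle polynomial, its horizontal arrows are the mediating arrows. -/
noncomputable def Sim.comp {C : Type u} [Category.{v} C] [HasFiniteLimits C] {P Q W : PE C}
    (S : Sim P Q) (T : Sim Q W) : Sim P W where
  R := pullback S.r₂ T.r₁
  RA := pullback S.α T.pA
  RD := pullback S.qD T.β
  r₁ := pullback.fst _ _ ≫ S.r₁
  r₂ := pullback.snd _ _ ≫ T.r₂
  pA := pullback.fst _ _ ≫ S.pA
  pR := pullback.map _ _ _ _ S.pR T.pR Q.a S.α_a T.isPullback_A.w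
  α := pullback.snd _ _ ≫ T.α
  qA := pullback.map _ _ _ _ S.qA T.qA Q.d S.isPullback_D.w T.β_d
  qD := pullback.snd _ _ ≫ T.qD
  β := pullback.fst _ _ ≫ S.β
  γ := pullback.map _ _ _ _ S.γ T.γ Q.n S.qD_n T.β_n
  isPullback_A := by
    have h := (IsPullback.of_hasPullback S.α T.pA).paste_vert T.isPullback_A
    have h' : IsPullback (pullback.fst S.α T.pA)
        (pullback.map S.α T.pA S.r₂ T.r₁ S.pR T.pR Q.a S.α_a T.isPullback_A.w) S.pR
        (pullback.fst S.r₂ T.r₁) := by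
      refine IsPullback.of_bot ?_ (by simp only [pullback.map, pullback.lift_fst, pullback.lift_snd])
        (IsPullback.of_hasPullback S.r₂ T.r₁)
      simpa [pullback.map, pullback.lift_fst, pullback.lift_snd, pullback.lift_fst_assoc,
        pullback.lift_snd_assoc, S.α_a] using h
    exact h'.paste_horiz S.isPullback_A
  isPullback_D := by
    have h := (IsPullback.of_hasPullback S.qD T.β).flip.paste_vert S.isPullback_D
    have h' : IsPullback (pullback.snd S.qD T.β)
        (pullback.map S.qD T.β S.α T.pA S.qA T.qA Q.d S.isPullback_D.w T.β_d) T.qA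
        (pullback.snd S.α T.pA) := by
      refine IsPullback.of_bot ?_ (by simp only [pullback.map, pullback.lift_fst, pullback.lift_snd])
        (IsPullback.of_hasPullback S.α T.pA).flip
      simpa [pullback.map, pullback.lift_fst, pullback.lift_snd, pullback.lift_fst_assoc,
        pullback.lift_snd_assoc, T.β_d] using h
    exact h'.paste_horiz T.isPullback_D
  α_a := by simp [pullback.map, pullback.lift_fst, pullback.lift_snd, pullback.lift_fst_assoc,
        pullback.lift_snd_assoc, T.α_a]
  β_d := by simp [pullback.map, pullback.lift_fst, pullback.lift_snd, pullback.lift_fst_assoc,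
        pullback.lift_snd_assoc, S.β_d]
  β_n := by simp [pullback.map, pullback.lift_fst, pullback.lift_snd, pullback.lift_fst_assoc,
        pullback.lift_snd_assoc, S.β_n]
  qD_n := by simp [pullback.map, pullback.lift_fst, pullback.lift_snd, pullback.lift_fst_assoc,
        pullback.lift_snd_assoc, T.qD_n]

/-- `Sim.comp` is a composite. -/
noncomputable def Sim.compIsComp {C : Type u} [Category.{v} C] [HasFiniteLimits C] {P Q W : PE C}
    (S : Sim P Q) (T : Sim Q W) : IsComp S T (S.comp T) where
  t := pullback.fst _ _
  t' := pullback.snd _ _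
  u := pullback.fst _ _
  u' := pullback.snd _ _
  w := pullback.fst _ _
  w' := pullback.snd _ _
  isPullback_t := IsPullback.of_hasPullback _ _
  isPullback_u := IsPullback.of_hasPullback _ _
  isPullback_w := IsPullback.of_hasPullback _ _
  r₁ := rfl
  r₂ := rfl
  pA := rfl
  pR := pullback.lift_fst _ _ _
  pR' := pullback.lift_snd _ _ _
  α := rfl
  qA := pullback.lift_fst _ _ _
  qA' := pullback.lift_snd _ _ _
  qD := rfl
  β := rfl
  γ := pullback.lift_fst _ _ _
  γ' := pullback.lift_snd _ _ _

/-- An isomorphism of polynomial diagrams. -/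
@[ext]
structure DiagIso {C : Type u} [Category.{v} C] (P Q : PE C) where
  eI : P.I ≅ Q.I
  eD : P.D ≅ Q.D
  eA : P.A ≅ Q.A
  n : eD.hom ≫ Q.n = P.n ≫ eI.hom
  d : eD.hom ≫ Q.d = P.d ≫ eA.hom
  a : eA.hom ≫ Q.a = P.a ≫ eI.hom

/-- The identity isomorphism of a polynomial diagram. -/
def DiagIso.refl {C : Type u} [Category.{v} C] (P : PE C) : DiagIso P P :=
  ⟨Iso.refl _, Iso.refl _, Iso.refl _, by simp, by simp, by simp⟩

/-- The inverse isomorphism of polynomial diagrams. -/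
def DiagIso.symm {C : Type u} [Category.{v} C] {P Q : PE C} (e : DiagIso P Q) : DiagIso Q P :=
  ⟨e.eI.symm, e.eD.symm, e.eA.symm, by simp [Iso.eq_comp_inv, ← e.n],
    by simp [Iso.eq_comp_inv, ← e.d], by simp [Iso.eq_comp_inv, ← e.a]⟩

/-- The simulation whose span is the graph of an isomorphism of polynomial diagrams. -/
def Sim.ofIso {C : Type u} [Category.{v} C] {P Q : PE C} (e : DiagIso P Q) : Sim P Q where
  R := P.I
  RA := P.A
  RD := P.D
  r₁ := 𝟙 _
  r₂ := e.eI.hom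
  pA := 𝟙 _
  pR := P.a
  α := e.eA.hom
  qA := P.d
  qD := e.eD.hom
  β := 𝟙 _
  γ := P.n
  isPullback_A := IsPullback.of_id_fst
  isPullback_D := IsPullback.of_horiz_isIso ⟨e.d⟩
  α_a := e.a
  β_d := by simp
  β_n := by simp
  qD_n := e.n

/-- The identity simulation is a left unit. -/
def Sim.idIsComp {C : Type u} [Category.{v} C] {P Q : PE C} (S : Sim P Q) :
    IsComp (Sim.ofIso (DiagIso.refl P)) S S where
  t := S.r₁
  t' := 𝟙 _
  u := S.pA
  u' := 𝟙 _
  w := S.β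
  w' := 𝟙 _
  isPullback_t := IsPullback.of_id_snd
  isPullback_u := IsPullback.of_id_snd
  isPullback_w := IsPullback.of_id_snd
  r₁ := by simp [Sim.ofIso]
  r₂ := by simp
  pA := by simp [Sim.ofIso]
  pR := by simp [Sim.ofIso, S.isPullback_A.w]
  pR' := by simp
  α := by simp
  qA := by simp [Sim.ofIso, S.β_d]
  qA' := by simp
  qD := by simp
  β := by simp [Sim.ofIso]
  γ := by simp [Sim.ofIso, S.β_n]
  γ' := by simp

/-- The identity simulation is a right unit. -/
def Sim.isCompId {C : Type u} [Category.{v} C] {P Q : PE C} (S : Sim P Q) :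
    IsComp S (Sim.ofIso (DiagIso.refl Q)) S where
  t := 𝟙 _
  t' := S.r₂
  u := 𝟙 _
  u' := S.α
  w := 𝟙 _
  w' := S.qD
  isPullback_t := IsPullback.of_id_fst
  isPullback_u := IsPullback.of_id_fst
  isPullback_w := IsPullback.of_id_fst
  r₁ := by simp
  r₂ := by simp [Sim.ofIso, DiagIso.refl]
  pA := by simp
  pR := by simp
  pR' := by simp [Sim.ofIso, S.α_a]
  α := by simp [Sim.ofIso, DiagIso.refl]
  qA := by simp
  qA' := by simp [Sim.ofIso, S.isPullback_D.w]
  qD := by simp [Sim.ofIso, DiagIso.refl]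
  β := by simp
  γ := by simp
  γ' := by simp [Sim.ofIso, S.qD_n]

/-- The graph of an isomorphism composed with the graph of its inverse. -/
def Sim.ofIsoIsComp {C : Type u} [Category.{v} C] {P Q : PE C} (e : DiagIso P Q) :
    IsComp (Sim.ofIso e) (Sim.ofIso e.symm) (Sim.ofIso (DiagIso.refl P)) where
  t := 𝟙 _
  t' := e.eI.hom
  u := 𝟙 _
  u' := e.eA.hom
  w := 𝟙 _
  w' := e.eD.hom
  isPullback_t := IsPullback.of_id_fst
  isPullback_u := IsPullback.of_id_fst
  isPullback_w := IsPullback.of_id_fst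
  r₁ := by simp [Sim.ofIso]
  r₂ := by simp [Sim.ofIso, DiagIso.refl, DiagIso.symm]
  pA := by simp [Sim.ofIso]
  pR := by simp [Sim.ofIso]
  pR' := by simp [Sim.ofIso, e.a]
  α := by simp [Sim.ofIso, DiagIso.refl, DiagIso.symm]
  qA := by simp [Sim.ofIso]
  qA' := by simp [Sim.ofIso, e.d]
  qD := by simp [Sim.ofIso, DiagIso.refl, DiagIso.symm]
  β := by simp [Sim.ofIso]
  γ := by simp [Sim.ofIso]
  γ' := by simp [Sim.ofIso, e.n]

/-- Composition of simulations is associative up to equivalence. -/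
noncomputable def Sim.assoc {C : Type u} [Category.{v} C] [HasFiniteLimits C] {P Q W Z : PE C}
    (S : Sim P Q) (T : Sim Q W) (U : Sim W Z) :
    SimIso ((S.comp T).comp U) (S.comp (T.comp U)) where
  σR := pullbackAssoc S.r₂ T.r₁ T.r₂ U.r₁
  σA := pullbackAssoc S.α T.pA T.α U.pA
  σD := pullbackAssoc S.qD T.β T.qD U.β
  r₁ := by simp [Sim.comp]
  r₂ := by simp [Sim.comp]
  pA := by simp [Sim.comp]
  pR := by
    dsimp only [Sim.comp]
    apply pullback.hom_ext
    · simp [pullback.map, pullback.lift_fst, pullback.lift_snd, pullback.lift_fst_assoc,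
        pullback.lift_snd_assoc]
    · apply pullback.hom_ext <;> simp [pullback.map, pullback.lift_fst, pullback.lift_snd, pullback.lift_fst_assoc,
        pullback.lift_snd_assoc]
  α := by simp [Sim.comp]
  qA := by
    dsimp only [Sim.comp]
    apply pullback.hom_ext
    · simp [pullback.map, pullback.lift_fst, pullback.lift_snd, pullback.lift_fst_assoc,
        pullback.lift_snd_assoc]
    · apply pullback.hom_ext <;> simp [pullback.map, pullback.lift_fst, pullback.lift_snd, pullback.lift_fst_assoc,
        pullback.lift_snd_assoc]
  qD := by simp [Sim.comp]
  β := by simp [Sim.comp]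
  γ := by
    dsimp only [Sim.comp]
    apply pullback.hom_ext
    · simp [pullback.map, pullback.lift_fst, pullback.lift_snd, pullback.lift_fst_assoc,
        pullback.lift_snd_assoc]
    · apply pullback.hom_ext <;> simp [pullback.map, pullback.lift_fst, pullback.lift_snd, pullback.lift_fst_assoc,
        pullback.lift_snd_assoc]

/-- The category `PE_C`: morphisms are equivalence classes of simulation diagrams. -/
noncomputable instance category {C : Type u} [Category.{v} C] [HasFiniteLimits C] :
    Category.{max u v} (PE C) where
  Hom P Q := Quotient (simSetoid P Q)
  id P := Quotient.mk _ (Sim.ofIso (DiagIso.refl P))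
  comp {P Q W} := Quotient.map₂ Sim.comp (fun S S' ⟨e⟩ T T' ⟨f⟩ =>
    (S.compIsComp T).unique (S'.compIsComp T') e f)
  id_comp {P Q} f := by
    induction f using Quotient.inductionOn with
    | h S => exact Quotient.sound ((Sim.compIsComp _ _).unique S.idIsComp (.refl _) (.refl _))
  comp_id {P Q} f := by
    induction f using Quotient.inductionOn with
    | h S => exact Quotient.sound ((Sim.compIsComp _ _).unique S.isCompId (.refl _) (.refl _))
  assoc {P Q W Z} f g h := by
    induction f using Quotient.inductionOn with
    | h S =>
      induction g using Quotient.inductionOn with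
      | h T =>
        induction h using Quotient.inductionOn with
        | h U => exact Quotient.sound ⟨Sim.assoc S T U⟩

/-- The morphism of `PE_C` represented by a simulation diagram. -/
def homMk {C : Type u} [Category.{v} C] [HasFiniteLimits C] {P Q : PE C} (S : Sim P Q) : P ⟶ Q :=
  Quotient.mk (simSetoid P Q) S

/-- The isomorphism of `PE_C` given by an isomorphism of polynomial diagrams. -/
def isoMk {C : Type u} [Category.{v} C] [HasFiniteLimits C] {P Q : PE C} (e : DiagIso P Q) :
    P ≅ Q where
  hom := homMk (Sim.ofIso e)
  inv := homMk (Sim.ofIso e.symm)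
  hom_inv_id :=
    Quotient.sound ((Sim.compIsComp _ _).unique (Sim.ofIsoIsComp e) (.refl _) (.refl _))
  inv_hom_id :=
    Quotient.sound ((Sim.compIsComp _ _).unique (Sim.ofIsoIsComp e.symm) (.refl _) (.refl _))

/-- The pointwise tensor product of polynomial diagrams. -/
noncomputable def tensor {C : Type u} [Category.{v} C] [HasFiniteLimits C] (P Q : PE C) :
    PE C where
  I := P.I ⨯ Q.I
  D := P.D ⨯ Q.D
  A := P.A ⨯ Q.A
  n := prod.map P.n Q.n
  d := prod.map P.d Q.d
  a := prod.map P.a Q.a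

/-- The neutral element `1 ← 1 → 1 → 1`. -/
noncomputable def unit (C : Type u) [Category.{v} C] [HasFiniteLimits C] : PE C where
  I := ⊤_ C
  D := ⊤_ C
  A := ⊤_ C
  n := 𝟙 _
  d := 𝟙 _
  a := 𝟙 _

/-- The product of two pullback squares is a pullback square. -/
theorem isPullback_prodMap {C : Type u} [Category.{v} C] [HasFiniteLimits C]
    {X Y Z B X' Y' Z' B' : C} {p : Z ⟶ X} {q : Z ⟶ Y} {g : X ⟶ B} {h : Y ⟶ B}
    {p' : Z' ⟶ X'} {q' : Z' ⟶ Y'} {g' : X' ⟶ B'} {h' : Y' ⟶ B'}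
    (H : IsPullback p q g h) (H' : IsPullback p' q' g' h') :
    IsPullback (prod.map p p') (prod.map q q') (prod.map g g') (prod.map h h') := by
  refine ⟨⟨by simp [H.w, H'.w]⟩, ⟨PullbackCone.IsLimit.mk _
    (fun s => prod.lift
      (H.lift (s.fst ≫ prod.fst) (s.snd ≫ prod.fst)
        (by simpa using s.condition =≫ prod.fst))
      (H'.lift (s.fst ≫ prod.snd) (s.snd ≫ prod.snd)
        (by simpa using s.condition =≫ prod.snd))) ?_ ?_ ?_⟩⟩
  · intro s
    apply Limits.prod.hom_ext <;> simp [prod.lift_fst, prod.lift_snd]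
  · intro s
    apply Limits.prod.hom_ext <;> simp [prod.lift_fst, prod.lift_snd]
  · intro s m h₁ h₂
    apply Limits.prod.hom_ext
    · apply H.hom_ext
      · simp [← h₁, prod.lift_fst_assoc]
      · simp [← h₂, prod.lift_fst_assoc]
    · apply H'.hom_ext
      · simp [← h₁, prod.lift_snd_assoc]
      · simp [← h₂, prod.lift_snd_assoc]

/-- Componentwise composition of products of morphisms. -/
theorem prodMap_comp {C : Type u} [Category.{v} C] [HasFiniteLimits C] {X Y Z X' Y' Z' : C}
    {f : X ⟶ Y} {g : Y ⟶ Z} {k : X ⟶ Z} {f' : X' ⟶ Y'} {g' : Y' ⟶ Z'} {k' : X' ⟶ Z'}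
    (h : f ≫ g = k) (h' : f' ≫ g' = k') : prod.map f f' ≫ prod.map g g' = prod.map k k' := by
  rw [prod.map_map, h, h']

/-- The pointwise tensor product of simulation diagrams. -/
noncomputable def Sim.tensor {C : Type u} [Category.{v} C] [HasFiniteLimits C]
    {P Q P' Q' : PE C} (S : Sim P Q) (T : Sim P' Q') : Sim (P.tensor P') (Q.tensor Q') where
  R := S.R ⨯ T.R
  RA := S.RA ⨯ T.RA
  RD := S.RD ⨯ T.RD
  r₁ := prod.map S.r₁ T.r₁
  r₂ := prod.map S.r₂ T.r₂
  pA := prod.map S.pA T.pA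
  pR := prod.map S.pR T.pR
  α := prod.map S.α T.α
  qA := prod.map S.qA T.qA
  qD := prod.map S.qD T.qD
  β := prod.map S.β T.β
  γ := prod.map S.γ T.γ
  isPullback_A := isPullback_prodMap S.isPullback_A T.isPullback_A
  isPullback_D := isPullback_prodMap S.isPullback_D T.isPullback_D
  α_a := by simp [PE.tensor, S.α_a, T.α_a]
  β_d := by simp [PE.tensor, S.β_d, T.β_d]
  β_n := by simp [PE.tensor, S.β_n, T.β_n]
  qD_n := by simp [PE.tensor, S.qD_n, T.qD_n]

/-- The tensor product of equivalence classes of simulation diagrams. -/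
noncomputable def tensorMap {C : Type u} [Category.{v} C] [HasFiniteLimits C]
    {P Q P' Q' : PE C} : (P ⟶ Q) → (P' ⟶ Q') → (P.tensor P' ⟶ Q.tensor Q') :=
  Quotient.map₂ Sim.tensor (fun _ _ ⟨e⟩ _ _ ⟨f⟩ =>
    ⟨⟨prod.mapIso e.σR f.σR, prod.mapIso e.σA f.σA, prod.mapIso e.σD f.σD,
      prodMap_comp e.r₁ f.r₁, prodMap_comp e.r₂ f.r₂, prodMap_comp e.pA f.pA,
      (prodMap_comp e.pR f.pR).trans (prodMap_comp rfl rfl).symm, prodMap_comp e.α f.α,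
      (prodMap_comp e.qA f.qA).trans (prodMap_comp rfl rfl).symm, prodMap_comp e.qD f.qD,
      prodMap_comp e.β f.β, (prodMap_comp e.γ f.γ).trans (prodMap_comp rfl rfl).symm⟩⟩)

/-- The associativity isomorphism, induced by that of the cartesian product of `C`. -/
noncomputable def associator {C : Type u} [Category.{v} C] [HasFiniteLimits C] (P Q W : PE C) :
    (P.tensor Q).tensor W ≅ P.tensor (Q.tensor W) :=
  isoMk
    { eI := prod.associator _ _ _
      eD := prod.associator _ _ _
      eA := prod.associator _ _ _
      n := prod.associator_naturality _ _ _ |>.symm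
      d := prod.associator_naturality _ _ _ |>.symm
      a := prod.associator_naturality _ _ _ |>.symm }

/-- The left unit isomorphism, induced by that of the cartesian product of `C`. -/
noncomputable def leftUnitor {C : Type u} [Category.{v} C] [HasFiniteLimits C] (P : PE C) :
    (unit C).tensor P ≅ P :=
  isoMk
    { eI := prod.leftUnitor _
      eD := prod.leftUnitor _
      eA := prod.leftUnitor _
      n := (prod.map_snd _ _).symm
      d := (prod.map_snd _ _).symm
      a := (prod.map_snd _ _).symm }

/-- The right unit isomorphism, induced by that of the cartesian product of `C`. -/
noncomputable def rightUnitor {C : Type u} [Category.{v} C] [HasFiniteLimits C] (P : PE C) :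
    P.tensor (unit C) ≅ P :=
  isoMk
    { eI := prod.rightUnitor _
      eD := prod.rightUnitor _
      eA := prod.rightUnitor _
      n := (prod.map_fst _ _).symm
      d := (prod.map_fst _ _).symm
      a := (prod.map_fst _ _).symm }

/-- The symmetry isomorphism, induced by that of the cartesian product of `C`. -/
noncomputable def braiding {C : Type u} [Category.{v} C] [HasFiniteLimits C] (P Q : PE C) :
    P.tensor Q ≅ Q.tensor P :=
  isoMk
    { eI := prod.braiding _ _
      eD := prod.braiding _ _
      eA := prod.braiding _ _
      n := by simp [PE.tensor]
      d := by simp [PE.tensor]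
      a := by simp [PE.tensor] }

/-- The data (without the axioms) of the monoidal structure of `PE_C`: the pointwise tensor
product, its unit, and the canonical isomorphisms. -/
noncomputable instance monoidalStruct {C : Type u} [Category.{v} C] [HasFiniteLimits C] :
    MonoidalCategoryStruct (PE C) where
  tensorObj := tensor
  tensorHom := tensorMap
  whiskerLeft P _ _ g := tensorMap (𝟙 P) g
  whiskerRight f P := tensorMap f (𝟙 P)
  tensorUnit := unit C
  associator := associator
  leftUnitor := leftUnitor
  rightUnitor := rightUnitor

section LinearHom

variable {C : Type u} [Category.{v} C] [HasFiniteLimits C] [LocallyCartesianClosed C]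

/-- The dependent product functor `Π_f : C/X ⥤ C/Y`, right adjoint to `Δ_f`. -/
noncomputable abbrev depProd {X Y : C} (f : X ⟶ Y) : Over X ⥤ Over Y :=
  (Over.pullback f).rightAdjoint

/-- The counit (evaluation) `Δ_f Π_f B ⟶ B` over `X`, as a morphism of `C` from the pullback of
`Π_f B` along `f` to the total space of `B`. -/
noncomputable def depEval {X Y : C} (f : X ⟶ Y) (B : Over X) :
    pullback ((depProd f).obj B).hom f ⟶ B.left :=
  ((Adjunction.ofIsLeftAdjoint (Over.pullback f)).counit.app B).left

variable (P Q : PE C)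

namespace LinHom

/-- The context `i₂ : I₂, i₃ : I₃, a₂ : A₂(i₂)` over the context `i₂ : I₂, i₃ : I₃`. -/
noncomputable abbrev actP : P.A ⨯ Q.I ⟶ P.I ⨯ Q.I := prod.map P.a (𝟙 Q.I)

/-- `i₂, i₃ ⊢ A₂(i₂) → A₃(i₃)`, that is `∏ a₂ : A₂(i₂), A₃(i₃)`; the type
`i₂, i₃, a₂ ⊢ A₃(i₃)` is interpreted by `1 × a₃ : A₂ × A₃ ⟶ A₂ × I₃`. -/
noncomputable def F : Over (P.I ⨯ Q.I) :=
  (depProd (actP P Q)).obj (Over.mk (prod.map (𝟙 P.A) Q.a))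

/-- The context `i₂, i₃, f : A₂(i₂) → A₃(i₃), a₂ : A₂(i₂)`. -/
noncomputable abbrev FA : C := pullback (F P Q).hom (actP P Q)

/-- The projection `(i₂, i₃, f, a₂) ↦ (i₂, i₃, f)`. -/
noncomputable abbrev FAtoF : FA P Q ⟶ (F P Q).left := pullback.fst _ _

/-- The morphism `(i₂, i₃, f, a₂) ↦ (a₂, f(a₂))`. -/
noncomputable def evF : FA P Q ⟶ P.A ⨯ Q.A :=
  depEval (actP P Q) (Over.mk (prod.map (𝟙 P.A) Q.a))

/-- The context `i₂, i₃, f, a₂, d₃ : D₃(i₃, f(a₂))`. -/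
noncomputable abbrev FAD : C := pullback Q.d (evF P Q ≫ prod.snd)

/-- The projection `(i₂, i₃, f, a₂, d₃) ↦ (i₂, i₃, f, a₂)`. -/
noncomputable abbrev FADtoFA : FAD P Q ⟶ FA P Q := pullback.snd _ _

/-- `i₂, i₃, f, a₂, d₃ ⊢ D₂(i₂, a₂)`. -/
noncomputable def D₂ : Over (FAD P Q) :=
  Over.mk (pullback.snd P.d (FADtoFA P Q ≫ evF P Q ≫ prod.fst))

/-- `i₂, i₃, f, a₂ ⊢ D₃(i₃, f(a₂)) → D₂(i₂, a₂)`. -/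
noncomputable def G : Over (FA P Q) := (depProd (FADtoFA P Q)).obj (D₂ P Q)

/-- `i₂, i₃, f ⊢ ∏ a₂ : A₂(i₂), D₃(i₃, f(a₂)) → D₂(i₂, a₂)`. -/
noncomputable def Φ : Over (F P Q).left := (depProd (FAtoF P Q)).obj (G P Q)

/-- The context `i₂, i₃, f, φ, a₂ : A₂(i₂)`. -/
noncomputable abbrev ΦA : C := pullback (Φ P Q).hom (FAtoF P Q)

/-- The morphism `(i₂, i₃, f, φ, a₂) ↦ (i₂, i₃, f, a₂, φ(a₂))`. -/
noncomputable def evΦ : ΦA P Q ⟶ (G P Q).left := depEval (FAtoF P Q) (G P Q)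

/-- `evΦ` is a morphism over the context `i₂, i₃, f, a₂`. -/
theorem evΦ_hom : evΦ P Q ≫ (G P Q).hom = pullback.snd (Φ P Q).hom (FAtoF P Q) :=
  Over.w ((Adjunction.ofIsLeftAdjoint (Over.pullback (FAtoF P Q))).counit.app (G P Q))

/-- The context `i₂, i₃, f, φ, a₂, d₃ : D₃(i₃, f(a₂))`. -/
noncomputable abbrev ΦAD : C :=
  pullback (FADtoFA P Q) (pullback.snd (Φ P Q).hom (FAtoF P Q))

/-- The projection `(i₂, i₃, f, φ, a₂, d₃) ↦ (i₂, i₃, f, φ, a₂)`. -/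
noncomputable abbrev ΦADtoΦA : ΦAD P Q ⟶ ΦA P Q := pullback.snd _ _

/-- The projection `(i₂, i₃, f, φ, a₂, d₃) ↦ (i₂, i₃, f, a₂, d₃)`. -/
noncomputable abbrev ΦADtoFAD : ΦAD P Q ⟶ FAD P Q := pullback.fst _ _

/-- The morphism `(i₂, i₃, f, φ, a₂, d₃) ↦ φ(a₂)(d₃) : D₂(i₂, a₂)`. -/
noncomputable def evD : ΦAD P Q ⟶ P.D :=
  pullback.lift (f := (G P Q).hom) (g := FADtoFA P Q) (ΦADtoΦA P Q ≫ evΦ P Q) (ΦADtoFAD P Q)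
    (by rw [Category.assoc, evΦ_hom, pullback.condition]) ≫
  depEval (FADtoFA P Q) (D₂ P Q) ≫
  pullback.fst P.d (FADtoFA P Q ≫ evF P Q ≫ prod.fst)

end LinHom

/-- The polynomial `P ⊸ Q`. Writing `P = (I₂ ← D₂ → A₂ → I₂)` and `Q = (I₃ ← D₃ → A₃ → I₃)`:
* its object of states is `I₂ × I₃`;
* `A(i₂, i₃) = ∑ f : A₂(i₂) → A₃(i₃), ∏ a₂ : A₂(i₂), D₃(i₃, f(a₂)) → D₂(i₂, a₂)`;
* `D(i₂, i₃, f, φ) = ∑ a₂ : A₂(i₂), D₃(i₃, f(a₂))`;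
* the next state is `(i₂[a₂ / φ(a₂)(d₃)], i₃[f(a₂) / d₃])`. -/
noncomputable def linHom : PE C where
  I := P.I ⨯ Q.I
  A := (LinHom.Φ P Q).left
  D := LinHom.ΦAD P Q
  a := (LinHom.Φ P Q).hom ≫ (LinHom.F P Q).hom
  d := LinHom.ΦADtoΦA P Q ≫ pullback.fst (LinHom.Φ P Q).hom (LinHom.FAtoF P Q)
  n := prod.lift (LinHom.evD P Q ≫ P.n)
    (LinHom.ΦADtoFAD P Q ≫ pullback.fst Q.d (LinHom.evF P Q ≫ prod.snd) ≫ Q.n)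

end LinearHom

end PE

/-- The axioms of a monoidal category, for given data (tensor product, unit, associator and
unitors). -/
structure MonoidalAxioms (D : Type u) [Category.{v} D] [MonoidalCategoryStruct D] : Prop where
  tensorHom_def : ∀ {X₁ Y₁ X₂ Y₂ : D} (f : X₁ ⟶ Y₁) (g : X₂ ⟶ Y₂), f ⊗ₘ g = (f ▷ X₂) ≫ (Y₁ ◁ g)
  id_tensorHom_id : ∀ X₁ X₂ : D, 𝟙 X₁ ⊗ₘ 𝟙 X₂ = 𝟙 (X₁ ⊗ X₂)
  tensorHom_comp_tensorHom : ∀ {X₁ Y₁ Z₁ X₂ Y₂ Z₂ : D} (f₁ : X₁ ⟶ Y₁) (f₂ : X₂ ⟶ Y₂)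
    (g₁ : Y₁ ⟶ Z₁) (g₂ : Y₂ ⟶ Z₂), (f₁ ⊗ₘ f₂) ≫ (g₁ ⊗ₘ g₂) = (f₁ ≫ g₁) ⊗ₘ (f₂ ≫ g₂)
  whiskerLeft_id : ∀ X Y : D, X ◁ 𝟙 Y = 𝟙 (X ⊗ Y)
  id_whiskerRight : ∀ X Y : D, 𝟙 X ▷ Y = 𝟙 (X ⊗ Y)
  associator_naturality : ∀ {X₁ X₂ X₃ Y₁ Y₂ Y₃ : D} (f₁ : X₁ ⟶ Y₁) (f₂ : X₂ ⟶ Y₂)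
    (f₃ : X₃ ⟶ Y₃),
    ((f₁ ⊗ₘ f₂) ⊗ₘ f₃) ≫ (α_ Y₁ Y₂ Y₃).hom = (α_ X₁ X₂ X₃).hom ≫ (f₁ ⊗ₘ (f₂ ⊗ₘ f₃))
  leftUnitor_naturality : ∀ {X Y : D} (f : X ⟶ Y), 𝟙_ D ◁ f ≫ (λ_ Y).hom = (λ_ X).hom ≫ f
  rightUnitor_naturality : ∀ {X Y : D} (f : X ⟶ Y), f ▷ 𝟙_ D ≫ (ρ_ Y).hom = (ρ_ X).hom ≫ f
  pentagon : ∀ W X Y Z : D,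
    (α_ W X Y).hom ▷ Z ≫ (α_ W (X ⊗ Y) Z).hom ≫ W ◁ (α_ X Y Z).hom =
      (α_ (W ⊗ X) Y Z).hom ≫ (α_ W X (Y ⊗ Z)).hom
  triangle : ∀ X Y : D, (α_ X (𝟙_ D) Y).hom ≫ X ◁ (λ_ Y).hom = (ρ_ X).hom ▷ Y

/-- The monoidal category given by data which satisfy the axioms. -/
abbrev MonoidalAxioms.toMonoidalCategory {D : Type u} [Category.{v} D]
    [S : MonoidalCategoryStruct D] (h : MonoidalAxioms D) : MonoidalCategory D where
  toMonoidalCategoryStruct := S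
  tensorHom_def := h.tensorHom_def
  id_tensorHom_id := h.id_tensorHom_id
  tensorHom_comp_tensorHom := h.tensorHom_comp_tensorHom
  whiskerLeft_id := h.whiskerLeft_id
  id_whiskerRight := h.id_whiskerRight
  associator_naturality := h.associator_naturality
  leftUnitor_naturality := h.leftUnitor_naturality
  rightUnitor_naturality := h.rightUnitor_naturality
  pentagon := h.pentagon
  triangle := h.triangle

/-!
# The symmetric monoidal closed category of polynomial diagrams and simulations

*Monoidal structure.* A composite in `PE C` may be computed with any choice of the three pullbacks
(`PE.homMk_comp`), and products of pullback squares are pullback squares, so the pointwise tensor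
product is functorial. The structural isomorphisms are graphs of isomorphisms of polynomial
diagrams. Such graphs compose and tensor as the isomorphisms do, so the coherence laws reduce,
component by component, to those of the cartesian product of `C`; naturality is
`PE.homMk_comp_ofIso`.

*Closed structure.* The indices 1, 2 and 3 refer to the objects of `P₁`, `P` and `Q`. A morphism
from `X` to the object of actions of `P ⊸ Q`, lying over
`x : X ⟶ I₂ × I₃`, classifies the following data: a morphism `g : Y ⟶ A₃` over `I₃`, where
`Y = X ×_{I₂} A₂`, and a morphism `h : Y ×_{A₃} D₃ ⟶ D₂` over `A₂`. This is obtained by applying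
the universal property of dependent products three times, once for each dependent product in the
definition of `P ⊸ Q` (`PE.LinHom.exists_lift`, `PE.LinHom.lift_ext`).

A simulation `S` from `P₁ ⊗ P` to `Q` has exactly such data over `X = A₁ ×_{I₁} R`: one has
`RA = X ×_{I₂} A₂`, the morphism `g` is `α`, and `h` is the second component of `β`. The first
component of `β` and the rest of `S` are the remaining data of a simulation from `P₁` to `P ⊸ Q`.
This shows that the evaluation simulation `(P ⊸ Q) ⊗ P ⟶ Q` is a universal arrow
(`PE.HomData.existsUnique_curry`): tensoring with `P` and composing with the evaluation is
uncurrying (`PE.HomData.uncurryIsComp`), which is surjective and injective up to equivalence of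
simulations. A family of universal arrows gives the functor of two variables and the natural
bijections (`MonoidalAxioms.exists_internalHom`).
-/

namespace PE

attribute [local simp] prod.lift_fst prod.lift_snd prod.lift_fst_assoc prod.lift_snd_assoc
  pullback.lift_fst pullback.lift_snd pullback.lift_fst_assoc pullback.lift_snd_assoc

variable {C : Type u} [Category.{v} C] [HasFiniteLimits C]

/-! ### Computing with representatives in `PE C` -/

theorem exists_homMk {P Q : PE C} (f : P ⟶ Q) : ∃ S : Sim P Q, homMk S = f :=
  Quotient.exists_rep f

theorem homMk_eq {P Q : PE C} {S T : Sim P Q} (e : SimIso S T) : homMk S = homMk T :=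
  Quotient.sound ⟨e⟩

theorem simIso_of_homMk_eq {P Q : PE C} {S T : Sim P Q} (h : homMk S = homMk T) :
    Nonempty (SimIso S T) :=
  Quotient.exact h

/-- Composites in `PE C` may be computed with any choice of the pullbacks. -/
theorem homMk_comp {P Q W : PE C} {S : Sim P Q} {T : Sim Q W} {U : Sim P W}
    (c : IsComp S T U) : homMk S ≫ homMk T = homMk U :=
  Quotient.sound ((S.compIsComp T).unique c (.refl _) (.refl _))

/-- The tensor product of composites is a composite of the tensor products. -/
noncomputable def IsComp.tensor {P Q W P' Q' W' : PE C} {S : Sim P Q} {T : Sim Q W}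
    {U : Sim P W} {S' : Sim P' Q'} {T' : Sim Q' W'} {U' : Sim P' W'}
    (c : IsComp S T U) (c' : IsComp S' T' U') :
    IsComp (S.tensor S') (T.tensor T') (U.tensor U') where
  t := prod.map c.t c'.t
  t' := prod.map c.t' c'.t'
  u := prod.map c.u c'.u
  u' := prod.map c.u' c'.u'
  w := prod.map c.w c'.w
  w' := prod.map c.w' c'.w'
  isPullback_t := isPullback_prodMap c.isPullback_t c'.isPullback_t
  isPullback_u := isPullback_prodMap c.isPullback_u c'.isPullback_u
  isPullback_w := isPullback_prodMap c.isPullback_w c'.isPullback_w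
  r₁ := (prodMap_comp c.r₁.symm c'.r₁.symm).symm
  r₂ := (prodMap_comp c.r₂.symm c'.r₂.symm).symm
  pA := (prodMap_comp c.pA.symm c'.pA.symm).symm
  pR := (prodMap_comp c.pR c'.pR).trans (prodMap_comp rfl rfl).symm
  pR' := (prodMap_comp c.pR' c'.pR').trans (prodMap_comp rfl rfl).symm
  α := (prodMap_comp c.α.symm c'.α.symm).symm
  qA := (prodMap_comp c.qA c'.qA).trans (prodMap_comp rfl rfl).symm
  qA' := (prodMap_comp c.qA' c'.qA').trans (prodMap_comp rfl rfl).symm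
  qD := (prodMap_comp c.qD.symm c'.qD.symm).symm
  β := (prodMap_comp c.β.symm c'.β.symm).symm
  γ := (prodMap_comp c.γ c'.γ).trans (prodMap_comp rfl rfl).symm
  γ' := (prodMap_comp c.γ' c'.γ').trans (prodMap_comp rfl rfl).symm

/-- The composite of isomorphisms of polynomial diagrams. -/
def DiagIso.trans {P Q W : PE C} (e : DiagIso P Q) (f : DiagIso Q W) : DiagIso P W :=
  ⟨e.eI ≪≫ f.eI, e.eD ≪≫ f.eD, e.eA ≪≫ f.eA, by simp [f.n, reassoc_of% e.n],
    by simp [f.d, reassoc_of% e.d], by simp [f.a, reassoc_of% e.a]⟩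

/-- The pointwise tensor product of isomorphisms of polynomial diagrams. -/
noncomputable def DiagIso.tensor {P Q P' Q' : PE C} (e : DiagIso P Q) (f : DiagIso P' Q') :
    DiagIso (P.tensor P') (Q.tensor Q') :=
  ⟨prod.mapIso e.eI f.eI, prod.mapIso e.eD f.eD, prod.mapIso e.eA f.eA,
    (prodMap_comp e.n f.n).trans (prodMap_comp rfl rfl).symm,
    (prodMap_comp e.d f.d).trans (prodMap_comp rfl rfl).symm,
    (prodMap_comp e.a f.a).trans (prodMap_comp rfl rfl).symm⟩

/-- The simulation `S` with its right leg transported along an isomorphism of polynomial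
diagrams. -/
def Sim.postIso {P Q W : PE C} (S : Sim P Q) (f : DiagIso Q W) : Sim P W where
  R := S.R
  RA := S.RA
  RD := S.RD
  r₁ := S.r₁
  r₂ := S.r₂ ≫ f.eI.hom
  pA := S.pA
  pR := S.pR
  α := S.α ≫ f.eA.hom
  qA := S.qA
  qD := S.qD ≫ f.eD.hom
  β := S.β
  γ := S.γ
  isPullback_A := S.isPullback_A
  isPullback_D := by
    have : IsPullback f.eD.hom Q.d W.d f.eA.hom := IsPullback.of_horiz_isIso ⟨f.d⟩
    exact S.isPullback_D.flip.paste_vert this.flip |>.flip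
  α_a := by simp [f.a, reassoc_of% S.α_a]
  β_d := S.β_d
  β_n := S.β_n
  qD_n := by simp [f.n, reassoc_of% S.qD_n]

/-- Transporting the right leg of `S` is composing with the graph of the isomorphism. -/
def Sim.postIsoIsComp {P Q W : PE C} (S : Sim P Q) (f : DiagIso Q W) :
    IsComp S (Sim.ofIso f) (S.postIso f) where
  t := 𝟙 _
  t' := S.r₂
  u := 𝟙 _
  u' := S.α
  w := 𝟙 _
  w' := S.qD
  isPullback_t := IsPullback.of_id_fst
  isPullback_u := IsPullback.of_id_fst
  isPullback_w := IsPullback.of_id_fst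
  r₁ := by simp [postIso]
  r₂ := by simp [Sim.ofIso, postIso]
  pA := by simp [postIso]
  pR := by simp [postIso]
  pR' := by simp [Sim.ofIso, S.α_a, postIso]
  α := by simp [Sim.ofIso, postIso]
  qA := by simp [postIso]
  qA' := by simp [Sim.ofIso, S.isPullback_D.w, postIso]
  qD := by simp [Sim.ofIso, postIso]
  β := by simp [postIso]
  γ := by simp [postIso]
  γ' := by simp [Sim.ofIso, S.qD_n, postIso]

theorem homMk_ofIso_comp {P Q W : PE C} (e : DiagIso P Q) (f : DiagIso Q W) :
    homMk (Sim.ofIso e) ≫ homMk (Sim.ofIso f) = homMk (Sim.ofIso (e.trans f)) :=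
  homMk_comp ((Sim.ofIso e).postIsoIsComp f)

theorem homMk_ofIso_tensor {P Q P' Q' : PE C} (e : DiagIso P Q) (f : DiagIso P' Q') :
    homMk (Sim.ofIso e) ⊗ₘ homMk (Sim.ofIso f) = homMk (Sim.ofIso (e.tensor f)) := by
  refine homMk_eq ⟨Iso.refl _, Iso.refl _, Iso.refl _, ?_, ?_, ?_, ?_, ?_, ?_, ?_, ?_, ?_⟩ <;>
    simp [Sim.tensor, Sim.ofIso, DiagIso.tensor, PE.tensor]

/-- Two simulations whose objects are isomorphic compatibly with isomorphisms `e` and `f` of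
their sources and targets give a commutative square in `PE C`. -/
theorem homMk_comp_ofIso {P Q P' Q' : PE C} {S : Sim P Q} {T : Sim P' Q'}
    (e : DiagIso P P') (f : DiagIso Q Q')
    (σR : S.R ≅ T.R) (σA : S.RA ≅ T.RA) (σD : S.RD ≅ T.RD)
    (r₁ : σR.hom ≫ T.r₁ = S.r₁ ≫ e.eI.hom) (r₂ : σR.hom ≫ T.r₂ = S.r₂ ≫ f.eI.hom)
    (pA : σA.hom ≫ T.pA = S.pA ≫ e.eA.hom) (pR : σA.hom ≫ T.pR = S.pR ≫ σR.hom)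
    (α : σA.hom ≫ T.α = S.α ≫ f.eA.hom) (qA : σD.hom ≫ T.qA = S.qA ≫ σA.hom)
    (qD : σD.hom ≫ T.qD = S.qD ≫ f.eD.hom) (β : σD.hom ≫ T.β = S.β ≫ e.eD.hom)
    (γ : σD.hom ≫ T.γ = S.γ ≫ σR.hom) :
    homMk S ≫ homMk (Sim.ofIso f) = homMk (Sim.ofIso e) ≫ homMk T := by
  rw [homMk_comp (S.postIsoIsComp f)]
  have hR : IsPullback S.r₁ σR.hom e.eI.hom T.r₁ := .of_vert_isIso ⟨r₁.symm⟩
  have hA : IsPullback S.pA σA.hom e.eA.hom T.pA := .of_vert_isIso ⟨pA.symm⟩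
  have hD : IsPullback S.β σD.hom e.eD.hom T.β := .of_vert_isIso ⟨β.symm⟩
  exact (homMk_comp
    { t := S.r₁, t' := σR.hom, u := S.pA, u' := σA.hom, w := S.β, w' := σD.hom
      isPullback_t := hR
      isPullback_u := hA
      isPullback_w := hD
      r₁ := by simp [Sim.ofIso, Sim.postIso]
      r₂ := by simp [Sim.postIso, r₂]
      pA := by simp [Sim.ofIso, Sim.postIso]
      pR := by simp [Sim.ofIso, Sim.postIso, S.isPullback_A.w]
      pR' := by simp [Sim.postIso, pR]
      α := by simp [Sim.postIso, α]
      qA := by simp [Sim.ofIso, Sim.postIso, S.β_d]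
      qA' := by simp [Sim.postIso, qA]
      qD := by simp [Sim.postIso, qD]
      β := by simp [Sim.ofIso, Sim.postIso]
      γ := by simp [Sim.ofIso, Sim.postIso, S.β_n]
      γ' := by simp [Sim.postIso, γ] }).symm

/-! ### The symmetric monoidal structure -/

theorem tensorHom_comp {P₁ Q₁ W₁ P₂ Q₂ W₂ : PE C} (f₁ : P₁ ⟶ Q₁) (f₂ : P₂ ⟶ Q₂)
    (g₁ : Q₁ ⟶ W₁) (g₂ : Q₂ ⟶ W₂) :
    (f₁ ⊗ₘ f₂) ≫ (g₁ ⊗ₘ g₂) = (f₁ ≫ g₁) ⊗ₘ (f₂ ≫ g₂) := by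
  obtain ⟨S₁, rfl⟩ := exists_homMk f₁
  obtain ⟨S₂, rfl⟩ := exists_homMk f₂
  obtain ⟨T₁, rfl⟩ := exists_homMk g₁
  obtain ⟨T₂, rfl⟩ := exists_homMk g₂
  rw [homMk_comp (S₁.compIsComp T₁), homMk_comp (S₂.compIsComp T₂)]
  exact homMk_comp ((S₁.compIsComp T₁).tensor (S₂.compIsComp T₂))

theorem id_eq_homMk (P : PE C) : 𝟙 P = homMk (Sim.ofIso (DiagIso.refl P)) := rfl

theorem id_tensorHom_id_eq (P Q : PE C) : 𝟙 P ⊗ₘ 𝟙 Q = 𝟙 (P ⊗ Q) := by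
  simp only [id_eq_homMk, homMk_ofIso_tensor]
  congr 2
  ext <;> simp [DiagIso.tensor, DiagIso.refl, MonoidalCategoryStruct.tensorObj, PE.tensor]

theorem monoidalAxioms : MonoidalAxioms (PE C) where
  tensorHom_def f g := by
    refine Eq.trans ?_ (tensorHom_comp _ _ _ _).symm
    rw [Category.comp_id, Category.id_comp]
  id_tensorHom_id := id_tensorHom_id_eq
  tensorHom_comp_tensorHom := tensorHom_comp
  whiskerLeft_id := id_tensorHom_id_eq
  id_whiskerRight := id_tensorHom_id_eq
  associator_naturality f₁ f₂ f₃ := by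
    obtain ⟨S₁, rfl⟩ := exists_homMk f₁
    obtain ⟨S₂, rfl⟩ := exists_homMk f₂
    obtain ⟨S₃, rfl⟩ := exists_homMk f₃
    exact homMk_comp_ofIso _ _ (prod.associator _ _ _) (prod.associator _ _ _)
      (prod.associator _ _ _)
      (prod.associator_naturality _ _ _).symm (prod.associator_naturality _ _ _).symm
      (prod.associator_naturality _ _ _).symm (prod.associator_naturality _ _ _).symm
      (prod.associator_naturality _ _ _).symm (prod.associator_naturality _ _ _).symm
      (prod.associator_naturality _ _ _).symm (prod.associator_naturality _ _ _).symm
      (prod.associator_naturality _ _ _).symm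
  leftUnitor_naturality f := by
    obtain ⟨S, rfl⟩ := exists_homMk f
    exact homMk_comp_ofIso _ _ (prod.leftUnitor _) (prod.leftUnitor _) (prod.leftUnitor _)
      (prod.map_snd _ _).symm (prod.map_snd _ _).symm (prod.map_snd _ _).symm
      (prod.map_snd _ _).symm (prod.map_snd _ _).symm (prod.map_snd _ _).symm
      (prod.map_snd _ _).symm (prod.map_snd _ _).symm (prod.map_snd _ _).symm
  rightUnitor_naturality f := by
    obtain ⟨S, rfl⟩ := exists_homMk f
    exact homMk_comp_ofIso _ _ (prod.rightUnitor _) (prod.rightUnitor _) (prod.rightUnitor _)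
      (prod.map_fst _ _).symm (prod.map_fst _ _).symm (prod.map_fst _ _).symm
      (prod.map_fst _ _).symm (prod.map_fst _ _).symm (prod.map_fst _ _).symm
      (prod.map_fst _ _).symm (prod.map_fst _ _).symm (prod.map_fst _ _).symm
  pentagon W X Y Z := by
    change (homMk (Sim.ofIso _) ⊗ₘ homMk (Sim.ofIso _)) ≫ homMk (Sim.ofIso _) ≫
      (homMk (Sim.ofIso _) ⊗ₘ homMk (Sim.ofIso _)) = homMk (Sim.ofIso _) ≫ homMk (Sim.ofIso _)
    simp only [homMk_ofIso_tensor, homMk_ofIso_comp]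
    congr 2
    ext1 <;> ext1 <;> exact prod.pentagon _ _ _ _
  triangle X Y := by
    change homMk (Sim.ofIso _) ≫ (homMk (Sim.ofIso _) ⊗ₘ homMk (Sim.ofIso _)) =
      (homMk (Sim.ofIso _) ⊗ₘ homMk (Sim.ofIso _))
    simp only [homMk_ofIso_tensor, homMk_ofIso_comp]
    congr 2
    ext1 <;> ext1 <;> exact prod.triangle _ _

theorem tensorHom_braiding {P Q P' Q' : PE C} (f : P ⟶ Q) (g : P' ⟶ Q') :
    (f ⊗ₘ g) ≫ (braiding Q Q').hom = (braiding P P').hom ≫ (g ⊗ₘ f) := by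
  obtain ⟨S, rfl⟩ := exists_homMk f
  obtain ⟨T, rfl⟩ := exists_homMk g
  have h {X Y X' Y' : C} (a : X ⟶ Y) (b : X' ⟶ Y') :
      (prod.braiding X X').hom ≫ prod.map b a = prod.map a b ≫ (prod.braiding Y Y').hom := by
    simp
  exact homMk_comp_ofIso _ _ (prod.braiding _ _) (prod.braiding _ _) (prod.braiding _ _)
    (h _ _) (h _ _) (h _ _) (h _ _) (h _ _) (h _ _) (h _ _) (h _ _) (h _ _)

theorem braiding_symmetry (P Q : PE C) :
    (braiding P Q).hom ≫ (braiding Q P).hom = 𝟙 (P ⊗ Q) := by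
  change homMk (Sim.ofIso _) ≫ homMk (Sim.ofIso _) = homMk (Sim.ofIso _)
  simp only [homMk_ofIso_comp]
  congr 2
  ext1 <;> ext1 <;> exact prod.symmetry _ _

theorem braiding_hexagon_forward (P Q W : PE C) :
    (α_ P Q W).hom ≫ (braiding P (Q ⊗ W)).hom ≫ (α_ Q W P).hom =
      ((braiding P Q).hom ▷ W) ≫ (α_ Q P W).hom ≫ (Q ◁ (braiding P W).hom) := by
  change homMk (Sim.ofIso _) ≫ homMk (Sim.ofIso _) ≫ homMk (Sim.ofIso _) =
    (homMk (Sim.ofIso _) ⊗ₘ homMk (Sim.ofIso _)) ≫ homMk (Sim.ofIso _) ≫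
      (homMk (Sim.ofIso _) ⊗ₘ homMk (Sim.ofIso _))
  simp only [homMk_ofIso_tensor, homMk_ofIso_comp]
  congr 2
  have h (X Y Z : C) : (prod.associator X Y Z).hom ≫ (prod.braiding X (Y ⨯ Z)).hom ≫
      (prod.associator Y Z X).hom = prod.map (prod.braiding X Y).hom (𝟙 Z) ≫
        (prod.associator Y X Z).hom ≫ prod.map (𝟙 Y) (prod.braiding X Z).hom := by
    ext <;> simp [prod.lift_fst, prod.lift_snd, prod.lift_fst_assoc, prod.lift_snd_assoc]
  ext1 <;> ext1 <;> exact h _ _ _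

theorem braiding_hexagon_reverse (P Q W : PE C) :
    (α_ P Q W).inv ≫ (braiding (P ⊗ Q) W).hom ≫ (α_ W P Q).inv =
      (P ◁ (braiding Q W).hom) ≫ (α_ P W Q).inv ≫ ((braiding P W).hom ▷ Q) := by
  change homMk (Sim.ofIso _) ≫ homMk (Sim.ofIso _) ≫ homMk (Sim.ofIso _) =
    (homMk (Sim.ofIso _) ⊗ₘ homMk (Sim.ofIso _)) ≫ homMk (Sim.ofIso _) ≫
      (homMk (Sim.ofIso _) ⊗ₘ homMk (Sim.ofIso _))
  simp only [homMk_ofIso_tensor, homMk_ofIso_comp]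
  congr 2
  have h (X Y Z : C) : (prod.associator X Y Z).inv ≫ (prod.braiding (X ⨯ Y) Z).hom ≫
      (prod.associator Z X Y).inv = prod.map (𝟙 X) (prod.braiding Y Z).hom ≫
        (prod.associator X Z Y).inv ≫ prod.map (prod.braiding X Z).hom (𝟙 Y) := by
    ext <;> simp [prod.lift_fst, prod.lift_snd, prod.lift_fst_assoc, prod.lift_snd_assoc]
  ext1 <;> ext1 <;> exact h _ _ _

/-- The symmetric monoidal structure on `PE C` whose braiding is the pointwise symmetry. -/
noncomputable abbrev symmetricCategory :
    @SymmetricCategory (PE C) _ monoidalAxioms.toMonoidalCategory :=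
  letI := (monoidalAxioms (C := C)).toMonoidalCategory
  { braiding := braiding
    braiding_naturality_right := fun _ _ _ _ => tensorHom_braiding _ _
    braiding_naturality_left := fun _ _ => tensorHom_braiding _ _
    hexagon_forward := braiding_hexagon_forward
    hexagon_reverse := braiding_hexagon_reverse
    symmetry := braiding_symmetry }

/-! ### Pullbacks along maps into products -/

/-- Pulling back `b × a` along `(1, c)` is pulling back `a` along `b ≫ c`. -/
theorem isPullback_graph {X Y A J K : C} {p : Y ⟶ A} {q : Y ⟶ X} {a : A ⟶ K} {b : X ⟶ J}
    {c : J ⟶ K} (H : IsPullback p q a (b ≫ c)) :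
    IsPullback (prod.lift q p) (q ≫ b) (prod.map b a) (prod.lift (𝟙 J) c) := by
  refine .mk' ?_ ?_ ?_
  · ext <;> simp [H.w]
  · intro T φ φ' h _
    apply H.hom_ext
    · simpa using h =≫ prod.snd
    · simpa using h =≫ prod.fst
  · intro T x y h
    have h₁ : x ≫ prod.fst ≫ b = y := by simpa using h =≫ prod.fst
    have h₂ : x ≫ prod.snd ≫ a = y ≫ c := by simpa using h =≫ prod.snd
    refine ⟨H.lift (x ≫ prod.snd) (x ≫ prod.fst) (by simp [h₂, ← h₁]), ?_, ?_⟩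
    · ext <;> simp
    · simp [h₁]

/-- Pulling back `1 × a` is pulling back `a`. -/
theorem isPullback_prodMap_id {X Y A I J : C} {p : Y ⟶ A} {q : Y ⟶ X} {a : A ⟶ I}
    {x : X ⟶ I ⨯ J} (H : IsPullback p q a (x ≫ prod.fst)) :
    IsPullback q (prod.lift p (q ≫ x ≫ prod.snd)) x (prod.map a (𝟙 J)) := by
  refine .mk' ?_ ?_ ?_
  · ext <;> simp [H.w]
  · intro T φ φ' h₁ h₂
    apply H.hom_ext
    · simpa using h₂ =≫ prod.fst
    · exact h₁
  · intro T y z h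
    have h₁ : y ≫ x ≫ prod.fst = z ≫ prod.fst ≫ a := by simpa using h =≫ prod.fst
    have h₂ : y ≫ x ≫ prod.snd = z ≫ prod.snd := by simpa using h =≫ prod.snd
    refine ⟨H.lift (z ≫ prod.fst) y (by simp [h₁]), by simp, ?_⟩
    ext <;> simp [h₂]

/-- A pullback of a product `a × b` is obtained by pulling back `a` and then `b`. -/
theorem isPullback_of_prodMap {X Y Z A B I J : C} {p : Z ⟶ A ⨯ B} {q : Z ⟶ X} {a : A ⟶ I}
    {b : B ⟶ J} {r : X ⟶ I ⨯ J} {p' : Y ⟶ A} {q' : Y ⟶ X} {m : Z ⟶ Y}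
    (H : IsPullback p q (prod.map a b) r) (H' : IsPullback p' q' a (r ≫ prod.fst))
    (h : m ≫ p' = p ≫ prod.fst) (h' : m ≫ q' = q) :
    IsPullback (p ≫ prod.snd) m b (q' ≫ r ≫ prod.snd) := by
  have hw₂ : p ≫ prod.snd ≫ b = q ≫ r ≫ prod.snd := by simpa using H.w =≫ prod.snd
  refine .mk' ?_ ?_ ?_
  · simp [hw₂, reassoc_of% h']
  · intro T φ φ' h₁ h₂
    apply H.hom_ext
    · ext
      · simpa [h] using h₂ =≫ p'
      · simpa using h₁
    · simpa [h'] using h₂ =≫ q'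
  · intro T x y e
    obtain ⟨l, hl, hl'⟩ := H.exists_lift (prod.lift (y ≫ p') x) (y ≫ q') (by
      ext
      · simp [H'.w]
      · simpa using e)
    refine ⟨l, by simp [reassoc_of% hl], ?_⟩
    apply H'.hom_ext
    · simp [h, reassoc_of% hl]
    · simp [h', hl']

/-- Pulling back `a` and then `b` is a pullback of the product `a × b`. -/
theorem isPullback_prodMap_of {X Y Z A B I J : C} {a : A ⟶ I} {b : B ⟶ J} {r : X ⟶ I ⨯ J}
    {p' : Y ⟶ A} {q' : Y ⟶ X} {m : Z ⟶ Y} {k : Z ⟶ B}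
    (H : IsPullback k m b (q' ≫ r ≫ prod.snd)) (H' : IsPullback p' q' a (r ≫ prod.fst)) :
    IsPullback (prod.lift (m ≫ p') k) (m ≫ q') (prod.map a b) r := by
  refine .mk' ?_ ?_ ?_
  · ext
    · simp [H'.w]
    · simp [H.w]
  · intro T φ φ' h₁ h₂
    apply H.hom_ext
    · simpa using h₁ =≫ prod.snd
    · apply H'.hom_ext
      · simpa using h₁ =≫ prod.fst
      · simpa using h₂
  · intro T x y e
    have e₁ : x ≫ prod.fst ≫ a = y ≫ r ≫ prod.fst := by simpa using e =≫ prod.fst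
    have e₂ : x ≫ prod.snd ≫ b = y ≫ r ≫ prod.snd := by simpa using e =≫ prod.snd
    obtain ⟨l, hl, hl'⟩ := H'.exists_lift (x ≫ prod.fst) y (by simpa using e₁)
    obtain ⟨l₂, hl₂, hl₂'⟩ := H.exists_lift (x ≫ prod.snd) l (by simp [reassoc_of% hl', e₂])
    refine ⟨l₂, ?_, by simp [reassoc_of% hl₂', hl']⟩
    ext <;> simp [reassoc_of% hl₂', hl, hl₂]

/-- A pullback square with sides `a` and `b` is also a pullback of `a × 1` and `(b, c)`. -/
theorem isPullback_lift {X Y Z A K : C} {y : Z ⟶ X} {m : Z ⟶ Y} {a : X ⟶ A} {b : Y ⟶ A}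
    (H : IsPullback y m a b) (c : Y ⟶ K) :
    IsPullback (prod.lift y (m ≫ c)) m (prod.map a (𝟙 K)) (prod.lift b c) := by
  refine .mk' ?_ ?_ ?_
  · apply Limits.prod.hom_ext <;> simp [H.w]
  · intro T φ φ' h h'
    apply H.hom_ext
    · simpa using h =≫ prod.fst
    · exact h'
  · intro T x z h
    have h₁ : x ≫ prod.fst ≫ a = z ≫ b := by simpa using h =≫ prod.fst
    have h₂ : x ≫ prod.snd = z ≫ c := by simpa using h =≫ prod.snd
    obtain ⟨l, hl, hl'⟩ := H.exists_lift (x ≫ prod.fst) z (by simpa using h₁)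
    refine ⟨l, ?_, hl'⟩
    apply Limits.prod.hom_ext <;> simp [hl, reassoc_of% hl', h₂]

theorem prodLift_map {W X Y X' Y' : C} {f : W ⟶ X} {g : W ⟶ Y} {h : X ⟶ X'} {k : Y ⟶ Y'}
    {f' : W ⟶ X'} {g' : W ⟶ Y'} (e : f ≫ h = f') (e' : g ≫ k = g') :
    prod.lift f g ≫ prod.map h k = prod.lift f' g' := by
  rw [prod.lift_map, e, e']

/-! ### Dependent products -/

/-- `E`, over `Y`, is a dependent product along `f : X ⟶ Y` of `b : B ⟶ X`, with evaluation `ev`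
defined on a pullback `W` of `E` along `f`. Transposes are taken along arbitrary pullback squares
instead of the chosen ones. -/
structure IsDepProd {X Y B E W : C} (f : X ⟶ Y) (b : B ⟶ X) (π : E ⟶ Y) (p₁ : W ⟶ E)
    (p₂ : W ⟶ X) (ev : W ⟶ B) : Prop where
  isPullback : IsPullback p₁ p₂ π f
  ev_comp : ev ≫ b = p₂
  exists_lift : ∀ {Z V : C} {p : V ⟶ Z} {q : V ⟶ X} {z : Z ⟶ Y}, IsPullback p q z f →
    ∀ h : V ⟶ B, h ≫ b = q →
      ∃ (k : Z ⟶ E) (m : V ⟶ W), k ≫ π = z ∧ m ≫ p₁ = p ≫ k ∧ m ≫ p₂ = q ∧ m ≫ ev = h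
  hom_ext : ∀ {Z V : C} {p : V ⟶ Z} {q : V ⟶ X} {z : Z ⟶ Y}, IsPullback p q z f →
    ∀ {k k' : Z ⟶ E} {m m' : V ⟶ W}, k ≫ π = z → k' ≫ π = z → m ≫ p₁ = p ≫ k →
      m' ≫ p₁ = p ≫ k' → m ≫ p₂ = q → m' ≫ p₂ = q → m ≫ ev = m' ≫ ev → k = k'

theorem pullback_map_left_fst {X Y : C} (f : X ⟶ Y) {U V : Over Y} (k : U ⟶ V) :
    ((Over.pullback f).map k).left ≫ pullback.fst V.hom f = pullback.fst U.hom f ≫ k.left :=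
  pullback.lift_fst _ _ _

theorem pullback_map_left_snd {X Y : C} (f : X ⟶ Y) {U V : Over Y} (k : U ⟶ V) :
    ((Over.pullback f).map k).left ≫ pullback.snd V.hom f = pullback.snd U.hom f :=
  pullback.lift_snd _ _ _

section LinearHom

variable [LocallyCartesianClosed C]

/-- The right adjoint `Π_f` of pullback, with the counit as evaluation, is a dependent product. -/
theorem isDepProd_depProd {X Y : C} (f : X ⟶ Y) (B : Over X) :
    IsDepProd f B.hom ((depProd f).obj B).hom (pullback.fst _ _) (pullback.snd _ _)
      (depEval f B) where
  isPullback := .of_hasPullback _ _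
  ev_comp := Over.w ((Adjunction.ofIsLeftAdjoint (Over.pullback f)).counit.app B)
  exists_lift {Z V p q z} H h hh := by
    let adj := Adjunction.ofIsLeftAdjoint (Over.pullback f)
    let g : (Over.pullback f).obj (Over.mk z) ⟶ B :=
      Over.homMk (H.isoPullback.inv ≫ h) (by simp [hh])
    let k : Over.mk z ⟶ (depProd f).obj B := adj.homEquiv _ _ g
    have hk : (Over.pullback f).map k ≫ adj.counit.app B = g :=
      (adj.homEquiv_counit _ _ _).symm.trans (Equiv.symm_apply_apply _ _)
    have hk' : ((Over.pullback f).map k).left ≫ depEval f B = H.isoPullback.inv ≫ h :=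
      congrArg CommaMorphism.left hk
    refine ⟨k.left, H.isoPullback.hom ≫ ((Over.pullback f).map k).left, Over.w k, ?_, ?_, ?_⟩
    · exact (Category.assoc _ _ _).trans ((congrArg _ (pullback_map_left_fst f k)).trans
        (H.isoPullback_hom_fst_assoc _))
    · exact (Category.assoc _ _ _).trans ((congrArg _ (pullback_map_left_snd f k)).trans
        H.isoPullback_hom_snd)
    · exact (Category.assoc _ _ _).trans ((congrArg _ hk').trans (Iso.hom_inv_id_assoc _ _))
  hom_ext {Z V p q z} H k k' m m' hk hk' h₁ h₁' h₂ h₂' h := by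
    let adj := Adjunction.ofIsLeftAdjoint (Over.pullback f)
    have key : ∀ (k : Over.mk z ⟶ (depProd f).obj B)
        (m : V ⟶ pullback ((depProd f).obj B).hom f) (_ : m ≫ pullback.fst _ _ = p ≫ k.left)
        (_ : m ≫ pullback.snd _ _ = q), ((adj.homEquiv (Over.mk z) B).symm k).left =
          H.isoPullback.inv ≫ m ≫ depEval f B := by
      intro k m h₁ h₂
      have e : ((Over.pullback f).map k).left = H.isoPullback.inv ≫ m := by
        apply pullback.hom_ext
        · rw [pullback_map_left_fst, Category.assoc, h₁, H.isoPullback_inv_fst_assoc]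
          rfl
        · rw [pullback_map_left_snd, Category.assoc, h₂, H.isoPullback_inv_snd]
          rfl
      have e' : ((adj.homEquiv (Over.mk z) B).symm k).left =
          ((Over.pullback f).map k).left ≫ depEval f B :=
        congrArg CommaMorphism.left (adj.homEquiv_counit _ _ _)
      rw [e', e]
      exact Category.assoc _ _ _
    have e : (adj.homEquiv (Over.mk z) B).symm (Over.homMk k hk) =
        (adj.homEquiv (Over.mk z) B).symm (Over.homMk k' hk') := by
      apply Over.OverMorphism.ext
      exact (key _ m h₁ h₂).trans ((congrArg _ h).trans (key _ m' h₁' h₂').symm)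
    exact congrArg CommaMorphism.left ((adj.homEquiv (Over.mk z) B).symm.injective e)

/-! ### The universal property of the internal hom -/

namespace LinHom

variable (P Q : PE C)

/-- The projection `(i₂, i₃, f, φ, a₂) ↦ (i₂, i₃, f, φ)`. -/
noncomputable abbrev ΦAtoΦ : ΦA P Q ⟶ (Φ P Q).left := pullback.fst _ _

/-- The projection `(i₂, i₃, f, φ, a₂) ↦ (i₂, i₃, f, a₂)`. -/
noncomputable abbrev ΦAtoFA : ΦA P Q ⟶ FA P Q := pullback.snd _ _

/-- The morphism `(i₂, i₃, f, φ, a₂) ↦ a₂`. -/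
noncomputable def evA₂ : ΦA P Q ⟶ P.A := ΦAtoFA P Q ≫ evF P Q ≫ prod.fst

/-- The morphism `(i₂, i₃, f, φ, a₂) ↦ f(a₂)`. -/
noncomputable def evA₃ : ΦA P Q ⟶ Q.A := ΦAtoFA P Q ≫ evF P Q ≫ prod.snd

/-- The morphism `(i₂, i₃, f, φ, a₂, d₃) ↦ d₃`. -/
noncomputable def evD₃ : ΦAD P Q ⟶ Q.D := ΦADtoFAD P Q ≫ pullback.fst _ _

/-- The evaluation `(i₂, i₃, f, a₂, ψ, d₃) ↦ (i₂, i₃, f, a₂, d₃, ψ(d₃))`, where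
`ψ : D₃(i₃, f(a₂)) → D₂(i₂, a₂)`. -/
noncomputable def evG : pullback (G P Q).hom (FADtoFA P Q) ⟶
    pullback P.d (FADtoFA P Q ≫ evF P Q ≫ prod.fst) :=
  depEval (FADtoFA P Q) (D₂ P Q)

/-- The morphism `(i₂, i₃, f, φ, a₂, d₃) ↦ (i₂, i₃, f, a₂, φ(a₂), d₃)`. -/
noncomputable def evΦD : ΦAD P Q ⟶ pullback (G P Q).hom (FADtoFA P Q) :=
  pullback.lift (ΦADtoΦA P Q ≫ evΦ P Q) (ΦADtoFAD P Q)
    (by rw [Category.assoc, evΦ_hom, pullback.condition])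

theorem evΦD_fst : evΦD P Q ≫ pullback.fst _ _ = ΦADtoΦA P Q ≫ evΦ P Q := pullback.lift_fst _ _ _

theorem evΦD_snd : evΦD P Q ≫ pullback.snd _ _ = ΦADtoFAD P Q := pullback.lift_snd _ _ _

theorem evD_eq : evD P Q = evΦD P Q ≫ evG P Q ≫ pullback.fst _ _ := rfl

theorem isDepProd_F : IsDepProd (actP P Q) (prod.map (𝟙 P.A) Q.a) (F P Q).hom (FAtoF P Q)
    (pullback.snd _ _) (evF P Q) :=
  isDepProd_depProd (actP P Q) (Over.mk (prod.map (𝟙 P.A) Q.a))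

theorem isDepProd_G : IsDepProd (FADtoFA P Q) (pullback.snd _ _) (G P Q).hom (pullback.fst _ _)
    (pullback.snd _ _) (evG P Q) :=
  isDepProd_depProd (FADtoFA P Q) (D₂ P Q)

theorem isDepProd_Φ : IsDepProd (FAtoF P Q) (G P Q).hom (Φ P Q).hom (ΦAtoΦ P Q) (ΦAtoFA P Q)
    (evΦ P Q) :=
  isDepProd_depProd _ _

theorem evF_fst : evF P Q ≫ prod.fst = pullback.snd (F P Q).hom (actP P Q) ≫ prod.fst := by
  simp [← (isDepProd_F P Q).ev_comp]

theorem evF_snd : evF P Q ≫ prod.snd ≫ Q.a =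
    pullback.snd (F P Q).hom (actP P Q) ≫ prod.snd := by
  simp [← (isDepProd_F P Q).ev_comp]

theorem evD_d : evD P Q ≫ P.d = ΦADtoΦA P Q ≫ evA₂ P Q := by
  rw [evD_eq, evA₂, Category.assoc, Category.assoc, pullback.condition,
    reassoc_of% (isDepProd_G P Q).ev_comp, reassoc_of% evΦD_snd, pullback.condition_assoc]

theorem isPullback_evA₂ :
    IsPullback (evA₂ P Q) (ΦAtoΦ P Q) P.a (((Φ P Q).hom ≫ (F P Q).hom) ≫ prod.fst) := by
  have h₁ := (IsPullback.of_hasPullback (Φ P Q).hom (FAtoF P Q)).flip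
  have h₂ := (IsPullback.of_hasPullback (F P Q).hom (actP P Q)).flip
  have h₃ : IsPullback (prod.fst : P.A ⨯ Q.I ⟶ P.A) (actP P Q) P.a prod.fst := by
    refine .mk' (by simp) ?_ ?_
    · intro T φ φ' h h'
      apply Limits.prod.hom_ext
      · exact h
      · simpa using h' =≫ prod.snd
    · intro T x y h
      exact ⟨prod.lift x (y ≫ prod.snd), by simp, by apply Limits.prod.hom_ext <;> simp [h]⟩
  have h := (h₁.paste_horiz h₂).paste_horiz h₃
  rwa [Category.assoc, ← evF_fst] at h

theorem isPullback_evD₃ : IsPullback (evD₃ P Q) (ΦADtoΦA P Q) Q.d (evA₃ P Q) := by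
  have h₁ := (IsPullback.of_hasPullback (FADtoFA P Q) (pullback.snd (Φ P Q).hom (FAtoF P Q)))
  have h₂ := (IsPullback.of_hasPullback Q.d (evF P Q ≫ prod.snd))
  exact h₁.paste_horiz h₂

theorem evA₃_a :
    evA₃ P Q ≫ Q.a = ΦAtoΦ P Q ≫ ((Φ P Q).hom ≫ (F P Q).hom) ≫ prod.snd := by
  have h := pullback.condition (f := (Φ P Q).hom) (g := FAtoF P Q)
  have h' := pullback.condition (f := (F P Q).hom) (g := actP P Q)
  simp only [evA₃, Category.assoc, evF_snd]
  rw [reassoc_of% h, reassoc_of% h']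
  simp [actP]

variable {P Q}

section

variable {X Y Z : C} {x : X ⟶ P.I ⨯ Q.I} {yA : Y ⟶ P.A} {yX : Y ⟶ X} {zD : Z ⟶ Q.D} {zY : Z ⟶ Y}

/-- The pair `(a₂, i₃)` underlying a morphism to the context `i₂, i₃, f, a₂` is determined by `a₂`
and by the context `x` of `f`. -/
theorem comp_snd_eq {f : X ⟶ (F P Q).left} {n : Y ⟶ FA P Q} (hf : f ≫ (F P Q).hom = x)
    (hn : n ≫ FAtoF P Q = yX ≫ f) (hn' : n ≫ evF P Q ≫ prod.fst = yA) :
    n ≫ pullback.snd _ _ = prod.lift yA (yX ≫ x ≫ prod.snd) := by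
  have h := pullback.condition (f := (F P Q).hom) (g := actP P Q)
  apply Limits.prod.hom_ext
  · rw [Category.assoc, ← evF_fst, hn', prod.lift_fst]
  · have h' := h =≫ prod.snd
    simp only [actP, Category.assoc, prod.map_snd, Category.comp_id] at h'
    rw [prod.lift_snd, Category.assoc, ← h', reassoc_of% hn, reassoc_of% hf]

/-- If `Y` is the context of an action `a₂` over `X`, then it is the pullback of the context
`i₂, i₃, f, a₂` along any `f : X ⟶ F`. -/
theorem isPullback_comp_FA {f : X ⟶ (F P Q).left} {n : Y ⟶ FA P Q}
    (HY : IsPullback yA yX P.a (x ≫ prod.fst)) (hf : f ≫ (F P Q).hom = x)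
    (hn : n ≫ FAtoF P Q = yX ≫ f) (hn' : n ≫ evF P Q ≫ prod.fst = yA) :
    IsPullback yX n f (FAtoF P Q) := by
  have H := (isPullback_prodMap_id HY).flip
  rw [← comp_snd_eq hf hn hn', ← hf] at H
  exact (IsPullback.of_right H hn (IsPullback.of_hasPullback _ _).flip).flip

/-- If `Z` is the context of a reaction `d₃ : D₃(f(a₂))` over `Y`, then it is the pullback of the
context `i₂, i₃, f, a₂, d₃` along `Y ⟶ FA`. -/
theorem isPullback_comp_FAD {n : Y ⟶ FA P Q} {r : Z ⟶ FAD P Q}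
    (HZ : IsPullback zD zY Q.d (n ≫ evF P Q ≫ prod.snd))
    (hr : r ≫ pullback.fst _ _ = zD) (hr' : r ≫ FADtoFA P Q = zY ≫ n) :
    IsPullback zY r n (FADtoFA P Q) := by
  subst hr
  exact (IsPullback.of_right HZ hr' (IsPullback.of_hasPullback _ _)).flip

/-- Given, in the context `x : X ⟶ I₂ × I₃`, a family of actions `g(a₂) : A₃` and a family
`h(a₂, d₃) : D₂(a₂)` indexed by `d₃ : D₃(g(a₂))`, there is a morphism from `X` to the object of
actions of `P ⊸ Q` along which they are pulled back from the evaluation maps. -/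
theorem exists_lift (HY : IsPullback yA yX P.a (x ≫ prod.fst)) {g : Y ⟶ Q.A}
    (hg : g ≫ Q.a = yX ≫ x ≫ prod.snd) (HZ : IsPullback zD zY Q.d g) {h : Z ⟶ P.D}
    (hh : h ≫ P.d = zY ≫ yA) :
    ∃ (k : X ⟶ (Φ P Q).left) (m : Y ⟶ ΦA P Q) (l : Z ⟶ ΦAD P Q),
      k ≫ (Φ P Q).hom ≫ (F P Q).hom = x ∧ m ≫ ΦAtoΦ P Q = yX ≫ k ∧
      m ≫ evA₂ P Q = yA ∧ m ≫ evA₃ P Q = g ∧ l ≫ ΦADtoΦA P Q = zY ≫ m ∧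
      l ≫ evD₃ P Q = zD ∧ l ≫ evD P Q = h := by
  obtain ⟨f, n, hf, hn₁, -, hn₃⟩ := (isDepProd_F P Q).exists_lift (isPullback_prodMap_id HY)
    (prod.lift yA g) (by apply Limits.prod.hom_ext <;> simp [hg])
  have hn₄ : n ≫ evF P Q ≫ prod.fst = yA := by rw [reassoc_of% hn₃, prod.lift_fst]
  have hn₅ : n ≫ evF P Q ≫ prod.snd = g := by rw [reassoc_of% hn₃, prod.lift_snd]
  let r : Z ⟶ FAD P Q := pullback.lift zD (zY ≫ n) (by rw [HZ.w, Category.assoc, hn₅])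
  have hr : r ≫ pullback.fst _ _ = zD := pullback.lift_fst _ _ _
  have hr' : r ≫ FADtoFA P Q = zY ≫ n := pullback.lift_snd _ _ _
  obtain ⟨b, s, hb, hs₁, hs₂, hs₃⟩ := (isDepProd_G P Q).exists_lift
    (isPullback_comp_FAD (by rwa [hn₅]) hr hr')
    (pullback.lift h r (by rw [reassoc_of% hr', hn₄, hh])) (pullback.lift_snd _ _ _)
  obtain ⟨k, m, hk, hm₁, hm₂, hm₃⟩ := (isDepProd_Φ P Q).exists_lift
    (isPullback_comp_FA HY hf hn₁ hn₄) b hb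
  let l : Z ⟶ ΦAD P Q := pullback.lift r (zY ≫ m) (by rw [hr', Category.assoc, hm₂])
  have hl₁ : l ≫ ΦADtoFAD P Q = r := pullback.lift_fst _ _ _
  have hl₂ : l ≫ ΦADtoΦA P Q = zY ≫ m := pullback.lift_snd _ _ _
  have hs : l ≫ evΦD P Q = s := by
    apply pullback.hom_ext
    · rw [Category.assoc, evΦD_fst, reassoc_of% hl₂, hm₃, hs₁]
    · rw [Category.assoc, evΦD_snd, hl₁, hs₂]
  refine ⟨k, m, l, ?_, hm₁, ?_, ?_, hl₂, ?_, ?_⟩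
  · rw [reassoc_of% hk, hf]
  · rw [evA₂, reassoc_of% hm₂, hn₄]
  · rw [evA₃, reassoc_of% hm₂, hn₅]
  · rw [evD₃, reassoc_of% hl₁, hr]
  · rw [evD_eq, reassoc_of% hs, reassoc_of% hs₃, pullback.lift_fst]

/-- A morphism to the object of actions of `P ⊸ Q` is determined by the families which are pulled
back along it from the evaluation maps. -/
theorem lift_ext (HY : IsPullback yA yX P.a (x ≫ prod.fst)) {g : Y ⟶ Q.A}
    (HZ : IsPullback zD zY Q.d g) {k k' : X ⟶ (Φ P Q).left} {m m' : Y ⟶ ΦA P Q}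
    {l l' : Z ⟶ ΦAD P Q} (hk : k ≫ (Φ P Q).hom ≫ (F P Q).hom = x) (hk' : k' ≫ (Φ P Q).hom ≫ (F P Q).hom = x)
    (hm₁ : m ≫ ΦAtoΦ P Q = yX ≫ k) (hm₁' : m' ≫ ΦAtoΦ P Q = yX ≫ k')
    (hm₂ : m ≫ evA₂ P Q = yA) (hm₂' : m' ≫ evA₂ P Q = yA)
    (hm₃ : m ≫ evA₃ P Q = g) (hm₃' : m' ≫ evA₃ P Q = g)
    (hl₁ : l ≫ ΦADtoΦA P Q = zY ≫ m) (hl₁' : l' ≫ ΦADtoΦA P Q = zY ≫ m')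
    (hl₂ : l ≫ evD₃ P Q = zD) (hl₂' : l' ≫ evD₃ P Q = zD)
    (hl₃ : l ≫ evD P Q = l' ≫ evD P Q) : k = k' := by
  have hf : (k ≫ (Φ P Q).hom) ≫ (F P Q).hom = x := by rw [Category.assoc, hk]
  have hf' : (k' ≫ (Φ P Q).hom) ≫ (F P Q).hom = x := by rw [Category.assoc, hk']
  have hn : (m ≫ ΦAtoFA P Q) ≫ FAtoF P Q = yX ≫ k ≫ (Φ P Q).hom := by
    rw [Category.assoc, ← pullback.condition, reassoc_of% hm₁]
  have hn' : (m' ≫ ΦAtoFA P Q) ≫ FAtoF P Q = yX ≫ k' ≫ (Φ P Q).hom := by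
    rw [Category.assoc, ← pullback.condition, reassoc_of% hm₁']
  have hA : (m ≫ ΦAtoFA P Q) ≫ evF P Q ≫ prod.fst = yA := by rw [Category.assoc]; exact hm₂
  have hA' : (m' ≫ ΦAtoFA P Q) ≫ evF P Q ≫ prod.fst = yA := by rw [Category.assoc]; exact hm₂'
  have hA₃ : (m ≫ ΦAtoFA P Q) ≫ evF P Q ≫ prod.snd = g := by rw [Category.assoc]; exact hm₃
  have hA₃' : (m' ≫ ΦAtoFA P Q) ≫ evF P Q ≫ prod.snd = g := by rw [Category.assoc]; exact hm₃'
  -- The functions `f` classified by `k` and `k'` agree.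
  have ef : k ≫ (Φ P Q).hom = k' ≫ (Φ P Q).hom := by
    refine (isDepProd_F P Q).hom_ext (isPullback_prodMap_id HY) hf hf' hn hn'
      (comp_snd_eq hf hn hA) (comp_snd_eq hf' hn' hA') ?_
    apply Limits.prod.hom_ext
    · rw [Category.assoc, hA, Category.assoc, hA']
    · rw [Category.assoc, hA₃, Category.assoc, hA₃']
  have en : m' ≫ ΦAtoFA P Q = m ≫ ΦAtoFA P Q := by
    apply pullback.hom_ext
    · rw [hn, hn', ef]
    · rw [comp_snd_eq hf hn hA, comp_snd_eq hf' hn' hA']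
  have hr : (l ≫ ΦADtoFAD P Q) ≫ FADtoFA P Q = zY ≫ m ≫ ΦAtoFA P Q := by
    rw [Category.assoc, pullback.condition, reassoc_of% hl₁]
  have hr' : (l' ≫ ΦADtoFAD P Q) ≫ FADtoFA P Q = zY ≫ m ≫ ΦAtoFA P Q := by
    rw [Category.assoc, pullback.condition, reassoc_of% hl₁', en]
  have hd : (l ≫ ΦADtoFAD P Q) ≫ pullback.fst _ _ = zD := by rw [Category.assoc]; exact hl₂
  have hd' : (l' ≫ ΦADtoFAD P Q) ≫ pullback.fst _ _ = zD := by rw [Category.assoc]; exact hl₂'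
  have er : l' ≫ ΦADtoFAD P Q = l ≫ ΦADtoFAD P Q := by
    apply pullback.hom_ext
    · rw [hd, hd']
    · rw [hr, hr']
  -- The functions `φ(a₂)` classified by `k` and `k'` agree.
  have eb : m ≫ evΦ P Q = m' ≫ evΦ P Q := by
    refine (isDepProd_G P Q).hom_ext (m := l ≫ evΦD P Q) (m' := l' ≫ evΦD P Q)
      (isPullback_comp_FAD (by rwa [hA₃]) hd hr) ?_ ?_ ?_ ?_ ?_ ?_ ?_
    · rw [Category.assoc, evΦ_hom]
    · rw [Category.assoc, evΦ_hom, en]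
    · rw [Category.assoc, evΦD_fst, reassoc_of% hl₁]
    · rw [Category.assoc, evΦD_fst, reassoc_of% hl₁']
    · rw [Category.assoc, evΦD_snd]
    · rw [Category.assoc, evΦD_snd, er]
    · apply pullback.hom_ext
      · simpa only [Category.assoc, evD_eq] using hl₃
      · simp only [Category.assoc, (isDepProd_G P Q).ev_comp, evΦD_snd, er]
  exact (isDepProd_Φ P Q).hom_ext (isPullback_comp_FA HY hf hn hA) rfl ef.symm hm₁ hm₁' rfl en eb

end

end LinHom
end LinearHom

/-! ### Currying simulations -/

/-- The universal property of `P ⊸ Q`, for a polynomial diagram `L` in its place: the states of `L`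
are pairs of states, and a morphism to `L.A` classifies a family of actions of `Q` indexed by the
actions of `P`, together with a family of reactions of `P` indexed by the reactions of `Q`. The
object `E` is the context of an action of `L` and an action of `P`. -/
structure HomData (P Q L : PE C) where
  l₁ : L.I ⟶ P.I
  l₂ : L.I ⟶ Q.I
  E : C
  toA : E ⟶ L.A
  toE : L.D ⟶ E
  evA₂ : E ⟶ P.A
  evA₃ : E ⟶ Q.A
  evD₂ : L.D ⟶ P.D
  evD₃ : L.D ⟶ Q.D
  toE_toA : toE ≫ toA = L.d
  evD₂_d : evD₂ ≫ P.d = toE ≫ evA₂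
  evD₂_n : evD₂ ≫ P.n = L.n ≫ l₁
  evD₃_n : evD₃ ≫ Q.n = L.n ≫ l₂
  evA₃_a : evA₃ ≫ Q.a = toA ≫ L.a ≫ l₂
  isPullback_evA₂ : IsPullback evA₂ toA P.a (L.a ≫ l₁)
  isPullback_evD₃ : IsPullback evD₃ toE Q.d evA₃
  exists_pair : ∀ {X : C} (f : X ⟶ P.I) (g : X ⟶ Q.I), ∃ k : X ⟶ L.I, k ≫ l₁ = f ∧ k ≫ l₂ = g
  pair_ext : ∀ {X : C} {k k' : X ⟶ L.I}, k ≫ l₁ = k' ≫ l₁ → k ≫ l₂ = k' ≫ l₂ → k = k'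
  exists_lift : ∀ {X Y Z : C} {x : X ⟶ L.I} {yA : Y ⟶ P.A} {yX : Y ⟶ X} {zD : Z ⟶ Q.D}
    {zY : Z ⟶ Y}, IsPullback yA yX P.a (x ≫ l₁) → ∀ {g : Y ⟶ Q.A}, g ≫ Q.a = yX ≫ x ≫ l₂ →
    IsPullback zD zY Q.d g → ∀ {h : Z ⟶ P.D}, h ≫ P.d = zY ≫ yA →
    ∃ (k : X ⟶ L.A) (m : Y ⟶ E) (l : Z ⟶ L.D),
      k ≫ L.a = x ∧ m ≫ toA = yX ≫ k ∧ m ≫ evA₂ = yA ∧ m ≫ evA₃ = g ∧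
      l ≫ toE = zY ≫ m ∧ l ≫ evD₃ = zD ∧ l ≫ evD₂ = h
  lift_ext : ∀ {X Y Z : C} {x : X ⟶ L.I} {yA : Y ⟶ P.A} {yX : Y ⟶ X} {zD : Z ⟶ Q.D}
    {zY : Z ⟶ Y}, IsPullback yA yX P.a (x ≫ l₁) → ∀ {g : Y ⟶ Q.A}, IsPullback zD zY Q.d g →
    ∀ {k k' : X ⟶ L.A} {m m' : Y ⟶ E} {l l' : Z ⟶ L.D}, k ≫ L.a = x → k' ≫ L.a = x →
    m ≫ toA = yX ≫ k → m' ≫ toA = yX ≫ k' → m ≫ evA₂ = yA → m' ≫ evA₂ = yA →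
    m ≫ evA₃ = g → m' ≫ evA₃ = g → l ≫ toE = zY ≫ m → l' ≫ toE = zY ≫ m' →
    l ≫ evD₃ = zD → l' ≫ evD₃ = zD → l ≫ evD₂ = l' ≫ evD₂ → k = k'

namespace HomData

variable {P Q L : PE C}

/-- The evaluation simulation from `(P ⊸ Q) ⊗ P` to `Q`: it relates `((i₂, i₃), i₂)` to `i₃`,
answers `((f, φ), a₂)` with `f(a₂)`, and translates `d₃` to `((a₂, d₃), φ(a₂)(d₃))`. -/
noncomputable def ev (H : HomData P Q L) : Sim (L.tensor P) Q where
  R := L.I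
  RA := H.E
  RD := L.D
  r₁ := prod.lift (𝟙 L.I) H.l₁
  r₂ := H.l₂
  pA := prod.lift H.toA H.evA₂
  pR := H.toA ≫ L.a
  α := H.evA₃
  qA := H.toE
  qD := H.evD₃
  β := prod.lift (𝟙 L.D) H.evD₂
  γ := L.n
  isPullback_A := isPullback_graph H.isPullback_evA₂
  isPullback_D := H.isPullback_evD₃
  α_a := by rw [H.evA₃_a, Category.assoc]
  β_d := by simp [PE.tensor, H.evD₂_d, H.toE_toA]
  β_n := by simp [PE.tensor, H.evD₂_n]
  qD_n := H.evD₃_n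

variable {P₁ : PE C}

/-- The simulation `P₁ ⊗ P ⟶ Q` given by a simulation `P₁ ⟶ P ⊸ Q`. -/
noncomputable def uncurry (H : HomData P Q L) (T : Sim P₁ L) : Sim (P₁.tensor P) Q where
  R := T.R
  RA := pullback T.α H.toA
  RD := T.RD
  r₁ := prod.lift T.r₁ (T.r₂ ≫ H.l₁)
  r₂ := T.r₂ ≫ H.l₂
  pA := prod.lift (pullback.fst _ _ ≫ T.pA) (pullback.snd _ _ ≫ H.evA₂)
  pR := pullback.fst _ _ ≫ T.pR
  α := pullback.snd _ _ ≫ H.evA₃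
  qA := pullback.lift T.qA (T.qD ≫ H.toE)
    (by rw [Category.assoc, H.toE_toA, T.isPullback_D.w])
  qD := T.qD ≫ H.evD₃
  β := prod.lift T.β (T.qD ≫ H.evD₂)
  γ := T.γ
  isPullback_A := by
    refine isPullback_prodMap_of (r := prod.lift T.r₁ (T.r₂ ≫ H.l₁)) ?_
      (by simpa using T.isPullback_A)
    have h := (IsPullback.of_hasPullback T.α H.toA).flip.paste_horiz H.isPullback_evA₂
    rwa [reassoc_of% T.α_a, ← prod.lift_snd T.r₁ (T.r₂ ≫ H.l₁)] at h
  isPullback_D := by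
    refine IsPullback.paste_horiz (IsPullback.of_bot ?_ (by simp)
      (IsPullback.of_hasPullback T.α H.toA).flip) H.isPullback_evD₃
    rw [pullback.lift_fst, H.toE_toA]
    exact T.isPullback_D
  α_a := by
    rw [Category.assoc, H.evA₃_a, ← pullback.condition_assoc, reassoc_of% T.α_a, Category.assoc]
  β_d := by simp [PE.tensor, H.evD₂_d, T.β_d]
  β_n := by simp [PE.tensor, H.evD₂_n, T.β_n, reassoc_of% T.qD_n]
  qD_n := by rw [Category.assoc, H.evD₃_n, reassoc_of% T.qD_n]

/-- Uncurrying is tensoring with `P` and composing with the evaluation. -/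
noncomputable def uncurryIsComp (H : HomData P Q L) (T : Sim P₁ L) :
    IsComp (T.tensor (Sim.ofIso (DiagIso.refl P))) H.ev (H.uncurry T) where
  t := prod.lift (𝟙 T.R) (T.r₂ ≫ H.l₁)
  t' := T.r₂
  u := prod.lift (pullback.fst _ _) (pullback.snd _ _ ≫ H.evA₂)
  u' := pullback.snd _ _
  w := prod.lift (𝟙 T.RD) (T.qD ≫ H.evD₂)
  w' := T.qD
  isPullback_t := isPullback_lift IsPullback.of_id_fst H.l₁
  isPullback_u := isPullback_lift (.of_hasPullback _ _) H.evA₂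
  isPullback_w := isPullback_lift IsPullback.of_id_fst H.evD₂
  r₁ := (prodLift_map (Category.id_comp _) (Category.comp_id _)).symm
  r₂ := rfl
  pA := (prodLift_map rfl (Category.comp_id _)).symm
  pR := (prod.comp_lift _ _ _).trans (prodLift_map (Category.comp_id _).symm (by
    have h : (pullback.snd T.α H.toA ≫ H.evA₂) ≫ P.a =
        (pullback.fst T.α H.toA ≫ T.pR) ≫ T.r₂ ≫ H.l₁ := by
      rw [Category.assoc, Category.assoc, H.isPullback_evA₂.w, ← pullback.condition_assoc,
        reassoc_of% T.α_a]
    exact h)).symm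
  pR' := by simp [uncurry, ev, T.α_a, ← pullback.condition_assoc]
  α := rfl
  qA := (prod.comp_lift _ _ _).trans (prodLift_map
    ((Category.id_comp _).trans (pullback.lift_fst _ _ _).symm) (by
      have h : pullback.lift (f := T.α) (g := H.toA) T.qA (T.qD ≫ H.toE)
          (by rw [Category.assoc, H.toE_toA, T.isPullback_D.w]) ≫ pullback.snd _ _ ≫ H.evA₂ =
          (T.qD ≫ H.evD₂) ≫ P.d := by
        rw [pullback.lift_snd_assoc, Category.assoc, Category.assoc, H.evD₂_d]
      exact h.symm)).symm
  qA' := pullback.lift_snd _ _ _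
  qD := rfl
  β := (prodLift_map (Category.id_comp _) (Category.comp_id _)).symm
  γ := (prod.comp_lift _ _ _).trans (prodLift_map ((Category.id_comp _).trans
    (Category.comp_id _).symm) (by
      have h : (T.qD ≫ H.evD₂) ≫ P.n = T.γ ≫ T.r₂ ≫ H.l₁ := by
        rw [Category.assoc, H.evD₂_n, reassoc_of% T.qD_n]
      exact h)).symm
  γ' := T.qD_n.symm

/-- Every simulation `P₁ ⊗ P ⟶ Q` is equivalent to an uncurried one. -/
theorem exists_uncurry_iso (H : HomData P Q L) (S : Sim (P₁.tensor P) Q) :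
    ∃ T : Sim P₁ L, Nonempty (SimIso (H.uncurry T) S) := by
  obtain ⟨R, RA, RD, r₁, r₂, pA, pR, α, qA, qD, β, γ, HA, HD, α_a, β_d, β_n, qD_n⟩ := S
  -- The data of `P₁.tensor P` are products by definition.
  change R ⟶ P₁.I ⨯ P.I at r₁
  change RA ⟶ P₁.A ⨯ P.A at pA
  change RD ⟶ P₁.D ⨯ P.D at β
  change IsPullback pA pR (prod.map P₁.a P.a) r₁ at HA
  change β ≫ prod.map P₁.d P.d = qA ≫ pA at β_d
  change β ≫ prod.map P₁.n P.n = γ ≫ r₁ at β_n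
  have β_d₁ : β ≫ prod.fst ≫ P₁.d = qA ≫ pA ≫ prod.fst := by simpa using β_d =≫ prod.fst
  have β_d₂ : β ≫ prod.snd ≫ P.d = qA ≫ pA ≫ prod.snd := by simpa using β_d =≫ prod.snd
  have β_n₁ : β ≫ prod.fst ≫ P₁.n = γ ≫ r₁ ≫ prod.fst := by simpa using β_n =≫ prod.fst
  have β_n₂ : β ≫ prod.snd ≫ P.n = γ ≫ r₁ ≫ prod.snd := by simpa using β_n =≫ prod.snd
  -- `r = (i₂, i₃)`, `B` is the context of an action of `P₁`, and `S` gives a family of actions and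
  -- reactions indexed by the actions of `P` over `B`; it is classified by `k : B ⟶ L.A`.
  obtain ⟨r, hr₁, hr₂⟩ := H.exists_pair (r₁ ≫ prod.snd) r₂
  let B := pullback P₁.a (r₁ ≫ prod.fst)
  let pB : B ⟶ P₁.A := pullback.fst _ _
  let qB : B ⟶ R := pullback.snd _ _
  have HB : IsPullback pB qB P₁.a (r₁ ≫ prod.fst) := .of_hasPullback _ _
  obtain ⟨y, hy₁, hy₂⟩ := HB.exists_lift (pA ≫ prod.fst) pR (by
    simpa using HA.w =≫ prod.fst)
  have HY : IsPullback (pA ≫ prod.snd) y P.a ((qB ≫ r) ≫ H.l₁) := by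
    rw [Category.assoc, hr₁]
    exact isPullback_of_prodMap HA HB hy₁ hy₂
  obtain ⟨k, m, l, hk, hm₁, hm₂, hm₃, hl₁, hl₂, hl₃⟩ := H.exists_lift HY (g := α)
    (by rw [α_a, Category.assoc, hr₂, reassoc_of% hy₂]) HD (h := β ≫ prod.snd)
    (by rw [Category.assoc, β_d₂])
  have Hm : IsPullback m y H.toA k := by
    refine IsPullback.of_right ?_ hm₁ H.isPullback_evA₂
    rw [hm₂, reassoc_of% hk]
    simpa using HY
  have Hl : IsPullback l qA H.toE m := by
    refine IsPullback.of_right ?_ hl₁ H.isPullback_evD₃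
    rwa [hl₂, hm₃]
  let T : Sim P₁ L :=
    { R := R, RA := B, RD := RD, r₁ := r₁ ≫ prod.fst, r₂ := r, pA := pB, pR := qB, α := k
      qA := qA ≫ y, qD := l, β := β ≫ prod.fst, γ := γ
      isPullback_A := HB
      isPullback_D := by
        rw [← H.toE_toA]
        exact Hl.paste_vert Hm
      α_a := hk
      β_d := by rw [Category.assoc, Category.assoc, hy₁, β_d₁]
      β_n := by rw [Category.assoc, β_n₁]
      qD_n := by
        apply H.pair_ext
        · rw [Category.assoc, ← H.evD₂_n, reassoc_of% hl₃, β_n₂, Category.assoc, hr₁]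
        · rw [Category.assoc, ← H.evD₃_n, reassoc_of% hl₂, qD_n, Category.assoc, hr₂] }
  obtain ⟨i, i₁, i₂⟩ : ∃ i : pullback k H.toA ≅ RA,
      i.hom ≫ y = pullback.fst _ _ ∧ i.hom ≫ m = pullback.snd _ _ :=
    ⟨Hm.flip.isoPullback.symm, Hm.flip.isoPullback_inv_fst, Hm.flip.isoPullback_inv_snd⟩
  refine ⟨T, ⟨⟨Iso.refl _, i, Iso.refl _, ?_, ?_, ?_, ?_, ?_, ?_, ?_, ?_, ?_⟩⟩⟩
  · change 𝟙 R ≫ r₁ = prod.lift (r₁ ≫ prod.fst) (r ≫ H.l₁)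
    apply Limits.prod.hom_ext <;> simp [hr₁]
  · change 𝟙 R ≫ r₂ = r ≫ H.l₂
    rw [Category.id_comp, hr₂]
  · change i.hom ≫ pA = prod.lift (pullback.fst k H.toA ≫ pB) (pullback.snd k H.toA ≫ H.evA₂)
    rw [← i₁, ← i₂]
    apply Limits.prod.hom_ext <;>
      simp only [Category.assoc, prod.lift_fst, prod.lift_snd, hy₁, hm₂]
  · change i.hom ≫ pR = (pullback.fst k H.toA ≫ qB) ≫ 𝟙 R
    rw [← i₁, Category.comp_id, Category.assoc, hy₂]
  · change i.hom ≫ α = pullback.snd k H.toA ≫ H.evA₃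
    rw [← i₂, Category.assoc, hm₃]
  · let q : RD ⟶ pullback k H.toA := (H.uncurry T).qA
    have q₁ : q ≫ pullback.fst _ _ = qA ≫ y := pullback.lift_fst _ _ _
    have q₂ : q ≫ pullback.snd _ _ = l ≫ H.toE := pullback.lift_snd _ _ _
    change 𝟙 RD ≫ qA = q ≫ i.hom
    rw [Category.id_comp]
    apply Hm.flip.hom_ext
    · rw [Category.assoc, i₁, q₁]
    · rw [Category.assoc, i₂, q₂, hl₁]
  · change 𝟙 RD ≫ qD = l ≫ H.evD₃
    rw [Category.id_comp, hl₂]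
  · change 𝟙 RD ≫ β = prod.lift (β ≫ prod.fst) (l ≫ H.evD₂)
    apply Limits.prod.hom_ext <;> simp [hl₃]
  · change 𝟙 RD ≫ γ = γ ≫ 𝟙 R
    rw [Category.id_comp, Category.comp_id]

/-- Simulations which are equivalent after uncurrying are equivalent. -/
theorem simIso_of_uncurry (H : HomData P Q L) {T T' : Sim P₁ L}
    (e : SimIso (H.uncurry T) (H.uncurry T')) : Nonempty (SimIso T T') := by
  obtain ⟨σR, σA, σD, hr₁, hr₂, hpA, hpR, hα, hqA, hqD, hβ, hγ⟩ := e
  change T.R ≅ T'.R at σR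
  change pullback T.α H.toA ≅ pullback T'.α H.toA at σA
  change T.RD ≅ T'.RD at σD
  let q : T.RD ⟶ pullback T.α H.toA := (H.uncurry T).qA
  let q' : T'.RD ⟶ pullback T'.α H.toA := (H.uncurry T').qA
  have q₁ : q ≫ pullback.fst _ _ = T.qA := pullback.lift_fst _ _ _
  have q₂ : q ≫ pullback.snd _ _ = T.qD ≫ H.toE := pullback.lift_snd _ _ _
  have q₁' : q' ≫ pullback.fst _ _ = T'.qA := pullback.lift_fst _ _ _
  have q₂' : q' ≫ pullback.snd _ _ = T'.qD ≫ H.toE := pullback.lift_snd _ _ _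
  change σR.hom ≫ prod.lift T'.r₁ (T'.r₂ ≫ H.l₁) = prod.lift T.r₁ (T.r₂ ≫ H.l₁) at hr₁
  change σR.hom ≫ T'.r₂ ≫ H.l₂ = T.r₂ ≫ H.l₂ at hr₂
  change σA.hom ≫ prod.lift (pullback.fst _ _ ≫ T'.pA) (pullback.snd _ _ ≫ H.evA₂) =
    prod.lift (pullback.fst _ _ ≫ T.pA) (pullback.snd _ _ ≫ H.evA₂) at hpA
  change σA.hom ≫ pullback.fst _ _ ≫ T'.pR = (pullback.fst _ _ ≫ T.pR) ≫ σR.hom at hpR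
  change σA.hom ≫ pullback.snd _ _ ≫ H.evA₃ = pullback.snd _ _ ≫ H.evA₃ at hα
  change σD.hom ≫ q' = q ≫ σA.hom at hqA
  change σD.hom ≫ T'.qD ≫ H.evD₃ = T.qD ≫ H.evD₃ at hqD
  change σD.hom ≫ prod.lift T'.β (T'.qD ≫ H.evD₂) = prod.lift T.β (T.qD ≫ H.evD₂) at hβ
  change σD.hom ≫ T'.γ = T.γ ≫ σR.hom at hγ
  have r₁ : σR.hom ≫ T'.r₁ = T.r₁ := by simpa using hr₁ =≫ prod.fst
  have r₂ : σR.hom ≫ T'.r₂ = T.r₂ := by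
    apply H.pair_ext
    · simpa using hr₁ =≫ prod.snd
    · simpa using hr₂
  have pA₁ : σA.hom ≫ pullback.fst _ _ ≫ T'.pA = pullback.fst _ _ ≫ T.pA := by
    simpa using hpA =≫ prod.fst
  have pA₂ : σA.hom ≫ pullback.snd _ _ ≫ H.evA₂ = pullback.snd _ _ ≫ H.evA₂ := by
    simpa using hpA =≫ prod.snd
  have β₁ : σD.hom ≫ T'.β = T.β := by simpa using hβ =≫ prod.fst
  have β₂ : σD.hom ≫ T'.qD ≫ H.evD₂ = T.qD ≫ H.evD₂ := by simpa using hβ =≫ prod.snd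
  -- The isomorphism `T.RA ≅ T'.RA` is induced by `σR`.
  let τ : T.RA ≅ T'.RA :=
    { hom := T'.isPullback_A.lift T.pA (T.pR ≫ σR.hom) (by simp [r₁, T.isPullback_A.w])
      inv := T.isPullback_A.lift T'.pA (T'.pR ≫ σR.inv) (by simp [← r₁, T'.isPullback_A.w])
      hom_inv_id := by apply T.isPullback_A.hom_ext <;> simp
      inv_hom_id := by apply T'.isPullback_A.hom_ext <;> simp }
  have τ₁ : τ.hom ≫ T'.pA = T.pA := T'.isPullback_A.lift_fst _ _ _
  have τ₂ : τ.hom ≫ T'.pR = T.pR ≫ σR.hom := T'.isPullback_A.lift_snd _ _ _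
  have hy : σA.hom ≫ pullback.fst _ _ = pullback.fst _ _ ≫ τ.hom := by
    apply T'.isPullback_A.hom_ext
    · simp [τ₁, pA₁]
    · simpa [τ₂] using hpR
  have α : τ.hom ≫ T'.α = T.α := by
    have HY := (IsPullback.of_hasPullback T.α H.toA).flip.paste_horiz H.isPullback_evA₂
    rw [← Category.assoc] at HY
    have HZ : IsPullback (T.qD ≫ H.evD₃) q Q.d (pullback.snd T.α H.toA ≫ H.evA₃) :=
      (H.uncurry T).isPullback_D
    refine H.lift_ext HY HZ (m := σA.hom ≫ pullback.snd _ _)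
      (m' := pullback.snd _ _) (l := σD.hom ≫ T'.qD) (l' := T.qD)
      ?_ rfl ?_ pullback.condition.symm ?_ rfl ?_ rfl ?_ q₂.symm ?_ rfl ?_
    · rw [Category.assoc, T'.α_a, reassoc_of% τ₂, r₂, T.α_a]
    · rw [Category.assoc, ← pullback.condition, reassoc_of% hy]
    · rw [Category.assoc, pA₂]
    · rw [Category.assoc, hα]
    · rw [Category.assoc, ← q₂', reassoc_of% hqA]
    · rw [Category.assoc, hqD]
    · rw [Category.assoc, β₂]
  -- Hence `σA` is compatible with the projections to `E`, which are determined by `a₂` and `α`.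
  have hm : σA.hom ≫ pullback.snd _ _ = pullback.snd T.α H.toA := by
    apply H.isPullback_evA₂.hom_ext
    · rw [Category.assoc, pA₂]
    · rw [Category.assoc, ← pullback.condition, reassoc_of% hy, α, pullback.condition]
  refine ⟨⟨σR, τ, σD, r₁, r₂, τ₁, τ₂, α, ?_, ?_, β₁, hγ⟩⟩
  · rw [← q₁', reassoc_of% hqA, hy, reassoc_of% q₁]
  · apply H.isPullback_evD₃.hom_ext
    · rw [Category.assoc, hqD]
    · rw [Category.assoc, ← q₂', reassoc_of% hqA, hm, q₂]

/-- The evaluation `L ⊗ P ⟶ Q` is universal: `L` represents `P₁ ↦ Hom (P₁ ⊗ P, Q)`. -/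
theorem existsUnique_curry (H : HomData P Q L) (φ : P₁ ⊗ P ⟶ Q) :
    ∃! ψ : P₁ ⟶ L, (ψ ⊗ₘ 𝟙 P) ≫ homMk H.ev = φ := by
  have h (T : Sim P₁ L) : (homMk T ⊗ₘ 𝟙 P) ≫ homMk H.ev = homMk (H.uncurry T) :=
    homMk_comp (H.uncurryIsComp T)
  obtain ⟨S, rfl⟩ := exists_homMk φ
  obtain ⟨T, ⟨e⟩⟩ := H.exists_uncurry_iso S
  refine ⟨homMk T, (h T).trans (homMk_eq e), fun ψ hψ => ?_⟩
  obtain ⟨T', rfl⟩ := exists_homMk ψ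
  obtain ⟨e'⟩ := simIso_of_homMk_eq ((h T').symm.trans (hψ.trans (homMk_eq e).symm))
  exact Quotient.sound (H.simIso_of_uncurry e')

end HomData

/-- `P ⊸ Q` has the universal property of the internal hom. -/
noncomputable def linHomData [LocallyCartesianClosed C] (P Q : PE C) :
    HomData P Q (linHom P Q) where
  l₁ := (prod.fst : P.I ⨯ Q.I ⟶ P.I)
  l₂ := (prod.snd : P.I ⨯ Q.I ⟶ Q.I)
  E := LinHom.ΦA P Q
  toA := LinHom.ΦAtoΦ P Q
  toE := LinHom.ΦADtoΦA P Q
  evA₂ := LinHom.evA₂ P Q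
  evA₃ := LinHom.evA₃ P Q
  evD₂ := LinHom.evD P Q
  evD₃ := LinHom.evD₃ P Q
  toE_toA := rfl
  evD₂_d := LinHom.evD_d P Q
  evD₂_n := (prod.lift_fst _ _).symm
  evD₃_n := (Category.assoc _ _ _).trans (prod.lift_snd _ _).symm
  evA₃_a := LinHom.evA₃_a P Q
  isPullback_evA₂ := LinHom.isPullback_evA₂ P Q
  isPullback_evD₃ := LinHom.isPullback_evD₃ P Q
  exists_pair f g := ⟨prod.lift f g, prod.lift_fst _ _, prod.lift_snd _ _⟩
  pair_ext h h' := Limits.prod.hom_ext h h'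
  exists_lift HY _ hg HZ _ hh := LinHom.exists_lift HY hg HZ hh
  lift_ext HY _ HZ _ _ _ _ _ _ := LinHom.lift_ext HY HZ

end PE

/-! ### The functor of two variables -/

/-- A family of universal arrows `ev P Q : L P Q ⊗ P ⟶ Q` makes `L` a functor of both variables
such that currying is natural in all three variables. -/
theorem MonoidalAxioms.exists_internalHom {D : Type u} [Category.{v} D] [MonoidalCategoryStruct D]
    (h : MonoidalAxioms D) (L : D → D → D) (ev : ∀ P Q, L P Q ⊗ P ⟶ Q)
    (hev : ∀ (X P Q : D) (φ : X ⊗ P ⟶ Q), ∃! ψ : X ⟶ L P Q, (ψ ⊗ₘ 𝟙 P) ≫ ev P Q = φ) :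
    ∃ H : Dᵒᵖ × D ⥤ D, (∀ P Q : D, H.obj (op P, Q) = L P Q) ∧
      ∃ e : ∀ X P Q : D, (X ⊗ P ⟶ Q) ≃ (X ⟶ H.obj (op P, Q)),
        ∀ {X X' P P' Q Q' : D} (f : X' ⟶ X) (g : P' ⟶ P) (k : Q ⟶ Q') (φ : X ⊗ P ⟶ Q),
          e X' P' Q' ((f ⊗ₘ g) ≫ φ ≫ k) = f ≫ e X P Q φ ≫ H.map (Prod.mkHom g.op k) := by
  -- `c X P Q φ` is the curried form of `φ`; `act g k` is the value of the functor on `(g, k)`.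
  choose c hc hu using hev
  simp only at hc hu
  have comp {X₁ Y₁ Z₁ X₂ Y₂ Z₂ : D} (f₁ : X₁ ⟶ Y₁) (f₂ : X₂ ⟶ Y₂) (g₁ : Y₁ ⟶ Z₁)
      (g₂ : Y₂ ⟶ Z₂) : (f₁ ⊗ₘ f₂) ≫ (g₁ ⊗ₘ g₂) = (f₁ ≫ g₁) ⊗ₘ (f₂ ≫ g₂) :=
    h.tensorHom_comp_tensorHom f₁ f₂ g₁ g₂
  let act {P P' Q Q' : D} (g : P' ⟶ P) (k : Q ⟶ Q') : L P Q ⟶ L P' Q' :=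
    c _ _ _ ((𝟙 _ ⊗ₘ g) ≫ ev P Q ≫ k)
  have hact {P P' Q Q' : D} (g : P' ⟶ P) (k : Q ⟶ Q') :
      (act g k ⊗ₘ 𝟙 P') ≫ ev P' Q' = (𝟙 _ ⊗ₘ g) ≫ ev P Q ≫ k := hc _ _ _ _
  -- The action of `(g, k)`, precomposed with `ψ`, uncurries to `(ψ ⊗ g) ≫ ev ≫ k`.
  have key {X P P' Q Q' : D} (ψ : X ⟶ L P Q) (g : P' ⟶ P) (k : Q ⟶ Q') :
      ((ψ ≫ act g k) ⊗ₘ 𝟙 P') ≫ ev P' Q' = (ψ ⊗ₘ g) ≫ ev P Q ≫ k := by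
    have e₁ := comp ψ (𝟙 P') (act g k) (𝟙 P')
    have e₂ := comp ψ (𝟙 P') (𝟙 _) g
    rw [Category.comp_id] at e₁ e₂
    rw [Category.id_comp] at e₂
    rw [← e₁, Category.assoc, hact, reassoc_of% e₂]
  let H : Dᵒᵖ × D ⥤ D :=
    { obj := fun X => L X.1.unop X.2
      map := fun f => act f.1.unop f.2
      map_id := fun X => (hu _ _ _ _ _ (by
        change (𝟙 _ ⊗ₘ 𝟙 _) ≫ ev _ _ = (𝟙 _ ⊗ₘ 𝟙 _) ≫ ev _ _ ≫ 𝟙 _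
        rw [Category.comp_id])).symm
      map_comp := fun {X Y Z} f g => (hu _ _ _ _ _ (by
        have e := comp (𝟙 (L X.1.unop X.2)) g.1.unop (𝟙 _) f.1.unop
        rw [Category.comp_id] at e
        rw [key, reassoc_of% (show (act f.1.unop f.2 ⊗ₘ g.1.unop) =
          (𝟙 _ ⊗ₘ g.1.unop) ≫ (act f.1.unop f.2 ⊗ₘ 𝟙 _) by
            rw [comp, Category.id_comp, Category.comp_id]), reassoc_of% hact, reassoc_of% e]
        rfl)).symm }
  refine ⟨H, fun _ _ => rfl, fun X P Q => ⟨c X P Q, fun ψ => (ψ ⊗ₘ 𝟙 P) ≫ ev P Q, hc _ _ _,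
    fun ψ => (hu _ _ _ _ _ rfl).symm⟩, ?_⟩
  intro X X' P P' Q Q' f g k φ
  refine (hu _ _ _ _ _ ?_).symm
  change ((f ≫ c X P Q φ ≫ act g k) ⊗ₘ 𝟙 P') ≫ ev P' Q' = _
  have e := comp f g (c X P Q φ) (𝟙 P)
  rw [Category.comp_id] at e
  rw [← Category.assoc, key, ← e, Category.assoc, reassoc_of% hc]

theorem mainTheorem1 {C : Type u} [Category.{v} C] [HasFiniteLimits C]
    [LocallyCartesianClosed C] :
    -- `PE_C` with the pointwise tensor product is a monoidal category,
    ∃ h : MonoidalAxioms (PE C),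
    -- symmetric for the pointwise symmetry,
    (∃ S : @SymmetricCategory (PE C) _ h.toMonoidalCategory,
      ∀ P₁ P₂ : PE C, S.braiding P₁ P₂ = PE.braiding P₁ P₂) ∧
    -- and the polynomials `P₂ ⊸ P₃` are the values of a functor `PE_Cᵒᵖ × PE_C ⥤ PE_C`
    ∃ H : (PE C)ᵒᵖ × PE C ⥤ PE C,
      (∀ P₂ P₃ : PE C, H.obj (op P₂, P₃) = PE.linHom P₂ P₃) ∧
      -- with bijections `PE_C[P₁ ⊗ P₂, P₃] ≃ PE_C[P₁, P₂ ⊸ P₃]`, natural in all the variables.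
      ∃ e : ∀ P₁ P₂ P₃ : PE C, (P₁ ⊗ P₂ ⟶ P₃) ≃ (P₁ ⟶ H.obj (op P₂, P₃)),
        ∀ {P₁ P₁' P₂ P₂' P₃ P₃' : PE C} (f : P₁' ⟶ P₁) (g : P₂' ⟶ P₂) (k : P₃ ⟶ P₃')
          (φ : P₁ ⊗ P₂ ⟶ P₃),
          e P₁' P₂' P₃' ((f ⊗ₘ g) ≫ φ ≫ k) = f ≫ e P₁ P₂ P₃ φ ≫ H.map (Prod.mkHom g.op k) :=
  ⟨PE.monoidalAxioms, ⟨PE.symmetricCategory, fun _ _ => rfl⟩,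
    PE.monoidalAxioms.exists_internalHom PE.linHom (fun P Q => PE.homMk (PE.linHomData P Q).ev)
      fun _ P Q φ => (PE.linHomData P Q).existsUnique_curry φ⟩
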